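/- \textbf{Setting.} Let $p\ge 1$, $B>0$, $\theta^\star\in\mathbb R^p$ with $\|\theta^\star\|_2\le B$, and let $(\mathcal X_t)_{t\ge1}$ be fixed (non-random) decision sets contained in the closed unit ball of $\mathbb R^p$. Choosing $X_t\in\mathcal X_t$ in round $t$ yields the reward $Y_t=\langle\theta^\star,X_t\rangle+\varepsilon_t$. Let $\mathcal F_t=\sigma(\varepsilon_1,\dots,\varepsilon_t)$, with $\mathcal F_0$ trivial. The noise is $(1,\phi)$-mixing sub-Gaussian for a non-negative non-increasing sequence $\phi$: each $\varepsilon_t$ is centred and $1$-sub-Gaussian, and for all $k\ge 1$ and $t>k$, almost surely, $|\mathbb E[\varepsilon_t\mid\mathcal F_{t-k}]|\le\phi_k$ and $\mathbb E[\exp(l(\varepsilon_t-\mathbb E[\varepsilon_t\mid\mathcal F_{t-k}]))\mid\mathcal F_{t-k}]\le e^{l^2/2}$ for every $l\in\mathbb R$. Fix a delay $d\ge 1$, $\delta\in(0,1)$ and $\lambda=1/B^2$, and put $$\beta_t^2=dp\log\frac{(B+1)^2e\max(dp,t+d)}{dp}+4\lambda B^2+2t\phi_d(B+1)+2d\log\frac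 d\delta .$$ Let $V_t=\sum_{s=1}^tX_sX_s^\top+\lambda\,\mathrm{Id}$, let $\widehat\theta_t$ be a minimiser of $\sum_{s=1}^t(\langle\theta,X_s\rangle-Y_s)^2$ over $\|\theta\|_2\le B$, and let $\mathcal C_t=\{\theta:\|\theta\|_2\le B,\ \langle\theta-\widehat\theta_t,V_t(\theta-\widehat\theta_t)\rangle\le\beta_t^2\}$. Mixing-LinUCB plays arbitrary non-random arms $X_t\in\mathcal X_t$ in rounds $t\le d$, and in every round $t>d$ an arm $X_t$ that maximises $x\mapsto\max_{\theta\in\mathcal C_{t-d}}\langle x,\theta\rangle$ over $\mathcal X_t$, with $X_t$ being $\mathcal F_{t-d}$-measurable. Its regret is $\mathrm{Reg}(T)=\sum_{t=1}^T\sup_{x\in\mathcal X_t}\langle x-X_t,\theta^\star\rangle$. \textbf{Theorem.} With probability at least $1-\delta$, the following holds for all $T>d$ and all $\Delta>0$: if in each round $t\le T$ there is an arm $X^\star_t\in\mathcal X_t$ maximising $\langle x,\theta^\star\rangle$ over $x\in\mathcal X_t$ with $\langle X_t^\star-x,\theta^\star\rangle\ge\Delta$ for every $x\in\mathcal X_t\setminus\{X_t^\star\}$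 (that is, the minimum gap up to round $T$ is at least $\Delta$), then $$\mathrm{Reg}(T)\le 2dB+\frac{8dp}{\Delta}\max(B^2,\beta_T^2)\log\Big(1+\frac{B^2T}{dp}\Big).$$ -/

import Mathlib

open MeasureTheory ProbabilityTheory
open scoped NNReal ENNReal InnerProductSpace

noncomputable section

namespace MixingBandit

/-- The `σ`-field `ℱ_t = σ(ε_1, …, ε_t)` generated by the noise of the rounds `1, …, t`
(so `ℱ_0` is trivial). -/
@[reducible] def noiseSigma {Ω : Type*} (ε : ℕ → Ω → ℝ) (t : ℕ) : MeasurableSpace Ω :=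
  ⨆ s ∈ Finset.Icc 1 t, MeasurableSpace.comap (ε s) (borel ℝ)

/-- The noise `(ε_t)_{t ≥ 1}` is `(σ, φ)`-mixing sub-Gaussian: `φ` is non-negative and
non-increasing, each `ε_t` is centred and `σ`-sub-Gaussian, and for each lag `k ≥ 1` and each
`t > k`, conditionally on `ℱ_{t-k}`, the mean of `ε_t` is at most `φ_k` in absolute value and the
recentred `ε_t` is `σ`-sub-Gaussian. The values `ε 0` and `φ 0` play no role. -/
structure IsMixingSubGaussian {Ω : Type*} [MeasurableSpace Ω] (μ : Measure Ω)
    (σ : ℝ≥0) (φ : ℕ → ℝ) (ε : ℕ → Ω → ℝ) : Prop where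
  phi_nonneg : ∀ k, 0 ≤ φ k
  phi_antitone : Antitone φ
  measurable : ∀ t, 1 ≤ t → Measurable (ε t)
  centred : ∀ t, 1 ≤ t → ∫ ω, ε t ω ∂μ = 0
  subGaussian : ∀ t, 1 ≤ t → HasSubgaussianMGF (ε t) (σ ^ 2) μ
  condMean_le : ∀ k t : ℕ, 1 ≤ k → k < t →
    ∀ᵐ ω ∂μ, |(μ[ε t | noiseSigma ε (t - k)]) ω| ≤ φ k
  condSubGaussian : ∀ k t : ℕ, 1 ≤ k → k < t → ∀ l : ℝ,
    ∀ᵐ ω ∂μ,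
      (μ[fun ω' => Real.exp (l * (ε t ω' - (μ[ε t | noiseSigma ε (t - k)]) ω'))
        | noiseSigma ε (t - k)]) ω ≤ Real.exp (l ^ 2 * (σ : ℝ) ^ 2 / 2)

/-- The regularised feature-covariance matrix `V_t = ∑_{s=1}^t X_s X_sᵀ + λ Id`. -/
def covMatrix {p : ℕ} (lam : ℝ) (x : ℕ → EuclideanSpace ℝ (Fin p)) (t : ℕ) :
    Matrix (Fin p) (Fin p) ℝ :=
  ∑ s ∈ Finset.Icc 1 t, Matrix.vecMulVec (x s).ofLp (x s).ofLp
    + lam • (1 : Matrix (Fin p) (Fin p) ℝ)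

/-- The squared weighted norm `‖u‖_A² = ⟨u, A u⟩`. -/
def weightedNormSq {p : ℕ} (A : Matrix (Fin p) (Fin p) ℝ) (u : EuclideanSpace ℝ (Fin p)) : ℝ :=
  u.ofLp ⬝ᵥ (A.mulVec u.ofLp)

/-- `θhat` is a minimiser of the squared loss `∑_{s=1}^t (⟨θ, x_s⟩ - y_s)²` over the closed ball
of radius `B`. -/
def IsLeastSquares {p : ℕ} (B : ℝ) (x : ℕ → EuclideanSpace ℝ (Fin p)) (y : ℕ → ℝ) (t : ℕ)
    (θhat : EuclideanSpace ℝ (Fin p)) : Prop :=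
  θhat ∈ Metric.closedBall (0 : EuclideanSpace ℝ (Fin p)) B ∧
    IsMinOn (fun θ => ∑ s ∈ Finset.Icc 1 t, (⟪θ, x s⟫_ℝ - y s) ^ 2)
      (Metric.closedBall (0 : EuclideanSpace ℝ (Fin p)) B) θhat

/-- The squared radius
`β_t² = d p log((B+1)² e max(dp, t+d) / (dp)) + 4 λ B² + 2 t φ_d (B+1) + 2 d log(d/δ)`. -/
def betaSq (p d : ℕ) (B lam δ : ℝ) (φ : ℕ → ℝ) (t : ℕ) : ℝ :=
  (d * p : ℝ) * Real.log ((B + 1) ^ 2 * Real.exp 1 * max (d * p : ℝ) (t + d : ℝ) / (d * p : ℝ))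
    + 4 * lam * B ^ 2 + 2 * t * φ d * (B + 1) + 2 * d * Real.log (d / δ)

/-- The confidence set `𝒞_t = {θ ∈ 𝓑(B) : ‖θ - θhat_t‖_{V_t}² ≤ β_t²}`. -/
def confSet {p : ℕ} (d : ℕ) (B lam δ : ℝ) (φ : ℕ → ℝ) (x : ℕ → EuclideanSpace ℝ (Fin p))
    (t : ℕ) (θhat : EuclideanSpace ℝ (Fin p)) : Set (EuclideanSpace ℝ (Fin p)) :=
  {θ | θ ∈ Metric.closedBall (0 : EuclideanSpace ℝ (Fin p)) B ∧
    weightedNormSq (covMatrix lam x t) (θ - θhat) ≤ betaSq p d B lam δ φ t}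

/-- The upper confidence bound `UCB_C(x) = max_{θ ∈ C} ⟨x, θ⟩`. -/
def ucb {p : ℕ} (C : Set (EuclideanSpace ℝ (Fin p))) (x : EuclideanSpace ℝ (Fin p)) : ℝ :=
  sSup ((fun θ => ⟪x, θ⟫_ℝ) '' C)

/-- The reward `Y_t = ⟨θ⋆, X_t⟩ + ε_t`. -/
def reward {Ω : Type*} {p : ℕ} (θstar : EuclideanSpace ℝ (Fin p)) (ε : ℕ → Ω → ℝ)
    (X : ℕ → Ω → EuclideanSpace ℝ (Fin p)) (t : ℕ) (ω : Ω) : ℝ :=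
  ⟪θstar, X t ω⟫_ℝ + ε t ω

/-- `X` is the sequence of arms played by Mixing-LinUCB with delay `d` (and `θhat` the
least-squares estimates used by it): the arm of round `t` lies in the decision set `𝒳_t` and is
determined by the noise up to round `t - d`; in the first `d` rounds it is an arbitrary
non-random arm, and in the rounds `t > d` it maximises `UCB_{𝒞_{t-d}}` over `𝒳_t`.
Ties in both optimisations may be broken in any way. -/
structure IsMixingLinUCB {Ω : Type*} {p : ℕ} (d : ℕ) (B lam δ : ℝ) (φ : ℕ → ℝ)
    (𝒳 : ℕ → Set (EuclideanSpace ℝ (Fin p))) (θstar : EuclideanSpace ℝ (Fin p))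
    (ε : ℕ → Ω → ℝ) (X θhat : ℕ → Ω → EuclideanSpace ℝ (Fin p)) : Prop where
  mem : ∀ t, 1 ≤ t → ∀ ω, X t ω ∈ 𝒳 t
  measurable : ∀ t, 1 ≤ t → Measurable[noiseSigma ε (t - d)] (X t)
  leastSquares : ∀ t, 1 ≤ t → ∀ ω,
    IsLeastSquares B (fun s => X s ω) (fun s => reward θstar ε X s ω) t (θhat t ω)
  optimistic : ∀ t, d < t → ∀ ω,
    IsMaxOn (ucb (confSet d B lam δ φ (fun s => X s ω) (t - d) (θhat (t - d) ω)))
      (𝒳 t) (X t ω)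

/-- The regret `Reg(T) = ∑_{t=1}^T sup_{x ∈ 𝒳_t} (⟨x, θ⋆⟩ - ⟨x_t, θ⋆⟩)` of the arms `x_t`. -/
def regret {p : ℕ} (𝒳 : ℕ → Set (EuclideanSpace ℝ (Fin p))) (θstar : EuclideanSpace ℝ (Fin p))
    (x : ℕ → EuclideanSpace ℝ (Fin p)) (T : ℕ) : ℝ :=
  ∑ t ∈ Finset.Icc 1 T, sSup ((fun z => ⟪z, θstar⟫_ℝ - ⟪x t, θstar⟫_ℝ) '' 𝒳 t)

/-- In each of the rounds `1, …, T` there is an optimal arm `X⋆_t`, and every other arm `z` of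
that round has `⟨X⋆_t - z, θ⋆⟩ ≥ Δ`; that is, the minimum gap up to `T` is at least `Δ`. -/
def HasGap {p : ℕ} (𝒳 : ℕ → Set (EuclideanSpace ℝ (Fin p))) (θstar : EuclideanSpace ℝ (Fin p))
    (T : ℕ) (Δ : ℝ) : Prop :=
  ∀ t ∈ Finset.Icc 1 T, ∃ xopt ∈ 𝒳 t, IsMaxOn (fun z => ⟪z, θstar⟫_ℝ) (𝒳 t) xopt ∧
    ∀ z ∈ 𝒳 t, z ≠ xopt → Δ ≤ ⟪xopt - z, θstar⟫_ℝ

end MixingBandit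

end

/-! Under the gap condition each round's regret is either zero or at least `Δ`, so it is at most its
square divided by `Δ`, and it suffices to bound a sum of squared regrets.

Confidence. The noise is recentred by its conditional mean given the past at delay `d`. Along each
of the `d` residue classes of rounds, likelihood ratios against `θ⋆` are then exponential
supermartingales. Mixing them over the uniform prior on the ball of radius `B + 1` and applying
Ville's inequality at level `d / δ` in each class gives one event of probability at least `1 - δ` on
which all parameters in the `B`-ball and all times are controlled (`confidence_event`). The rest is
deterministic (`regret_le_of_confidence`).

Covered rounds. If `θ⋆` lies in the confidence set, optimism bounds the squared regret by `4 max(B²,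
β_T²) min(1, q_t)`, where `q_t` is the leverage of round `t` within its own class. Earlier rounds of
the class are at least `d` rounds old, so the delay disappears and the potential argument telescopes
class by class (`sum_min_one_blockLeverage_le`).

Uncovered rounds. The bias can contribute up to `4tBφ_d`, while the radius only allows `2tφ_d(B +
1)`, so coverage may fail when `B > 1`. A failure forces the predictions of the estimator to be far
from the truth on average, which bounds the number of observed rounds by the noise radius
(`lt_noiseRadiusSq_of_not_covered`). Either `T` is so small that the trivial regret bound suffices,
or `φ_d` is small enough for the uncovered rounds to be few. Of the constant 8, covered rounds use 6
and uncovered rounds use 2. -/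

noncomputable section

namespace MixingBandit

/-! ### The elliptical potential -/

section Potential

variable {p : ℕ}

/-- The regularised Gram matrix `∑_{k < n} x_k x_kᵀ + λ Id`. -/
def gramMatrix (lam : ℝ) (x : ℕ → EuclideanSpace ℝ (Fin p)) (n : ℕ) :
    Matrix (Fin p) (Fin p) ℝ :=
  ∑ k ∈ Finset.range n, Matrix.vecMulVec (x k).ofLp (x k).ofLp
    + lam • (1 : Matrix (Fin p) (Fin p) ℝ)

/-- The leverage `x_nᵀ (∑_{k < n} x_k x_kᵀ + λ Id)⁻¹ x_n` of the `n`-th point given the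
previous ones. -/
def leverage (lam : ℝ) (x : ℕ → EuclideanSpace ℝ (Fin p)) (n : ℕ) : ℝ :=
  weightedNormSq (gramMatrix lam x n)⁻¹ (x n)

lemma real_inner_eq_dotProduct (u v : EuclideanSpace ℝ (Fin p)) :
    ⟪u, v⟫_ℝ = u.ofLp ⬝ᵥ v.ofLp := by
  rw [EuclideanSpace.inner_eq_star_dotProduct, dotProduct_comm]
  simp

lemma weightedNormSq_sum_vecMulVec_add {ι : Type*} (s : Finset ι) (lam : ℝ)
    (x : ι → EuclideanSpace ℝ (Fin p)) (u : EuclideanSpace ℝ (Fin p)) :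
    weightedNormSq (∑ k ∈ s, Matrix.vecMulVec (x k).ofLp (x k).ofLp
      + lam • (1 : Matrix (Fin p) (Fin p) ℝ)) u
      = ∑ k ∈ s, ⟪u, x k⟫_ℝ ^ 2 + lam * ‖u‖ ^ 2 := by
  unfold weightedNormSq
  rw [Matrix.add_mulVec, dotProduct_add, Matrix.sum_mulVec, dotProduct_sum]
  congr 1
  · refine Finset.sum_congr rfl fun k _ => ?_
    rw [Matrix.vecMulVec_mulVec, real_inner_eq_dotProduct]
    simp [dotProduct_comm (x k).ofLp u.ofLp, sq]
  · rw [Matrix.smul_mulVec, Matrix.one_mulVec, dotProduct_smul, ← real_inner_eq_dotProduct,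
      real_inner_self_eq_norm_sq, smul_eq_mul]

lemma weightedNormSq_covMatrix (lam : ℝ) (x : ℕ → EuclideanSpace ℝ (Fin p)) (t : ℕ)
    (u : EuclideanSpace ℝ (Fin p)) :
    weightedNormSq (covMatrix lam x t) u
      = ∑ s ∈ Finset.Icc 1 t, ⟪u, x s⟫_ℝ ^ 2 + lam * ‖u‖ ^ 2 :=
  weightedNormSq_sum_vecMulVec_add _ _ _ _

lemma weightedNormSq_gramMatrix (lam : ℝ) (x : ℕ → EuclideanSpace ℝ (Fin p)) (n : ℕ)
    (u : EuclideanSpace ℝ (Fin p)) :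
    weightedNormSq (gramMatrix lam x n) u
      = ∑ k ∈ Finset.range n, ⟪u, x k⟫_ℝ ^ 2 + lam * ‖u‖ ^ 2 :=
  weightedNormSq_sum_vecMulVec_add _ _ _ _

lemma gramMatrix_posDef {lam : ℝ} (hlam : 0 < lam) (x : ℕ → EuclideanSpace ℝ (Fin p)) (n : ℕ) :
    (gramMatrix lam x n).PosDef := by
  unfold gramMatrix
  refine Matrix.PosDef.posSemidef_add (Matrix.posSemidef_sum _ fun k _ => ?_)
    (Matrix.PosDef.one.smul hlam)
  simpa using Matrix.posSemidef_vecMulVec_self_star (x k).ofLp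

lemma gramMatrix_succ (lam : ℝ) (x : ℕ → EuclideanSpace ℝ (Fin p)) (n : ℕ) :
    gramMatrix lam x (n + 1)
      = gramMatrix lam x n + Matrix.vecMulVec (x n).ofLp (x n).ofLp := by
  unfold gramMatrix
  rw [Finset.sum_range_succ]
  abel

lemma leverage_nonneg {lam : ℝ} (hlam : 0 < lam) (x : ℕ → EuclideanSpace ℝ (Fin p)) (n : ℕ) :
    0 ≤ leverage lam x n := by
  simpa [leverage, weightedNormSq] using
    (gramMatrix_posDef hlam x n).inv.posSemidef.dotProduct_mulVec_nonneg (x n).ofLp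

lemma det_gramMatrix_succ {lam : ℝ} (hlam : 0 < lam) (x : ℕ → EuclideanSpace ℝ (Fin p)) (n : ℕ) :
    (gramMatrix lam x (n + 1)).det = (gramMatrix lam x n).det * (1 + leverage lam x n) := by
  have hu : IsUnit (gramMatrix lam x n).det := (gramMatrix_posDef hlam x n).det_pos.ne'.isUnit
  rw [gramMatrix_succ, Matrix.vecMulVec_eq Unit, Matrix.det_add_replicateCol_mul_replicateRow hu]
  congr 1
  rw [Matrix.det_unique, Matrix.add_apply, Matrix.one_apply_eq, ← Matrix.replicateRow_vecMul,
    Matrix.replicateRow_mul_replicateCol_apply, leverage, weightedNormSq,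
    Matrix.dotProduct_mulVec]

/-- The Cauchy–Schwarz inequality for a positive definite matrix and its inverse. -/
lemma inner_sq_le_weightedNormSq_inv_mul {A : Matrix (Fin p) (Fin p) ℝ} (hA : A.PosDef)
    (u v : EuclideanSpace ℝ (Fin p)) :
    ⟪u, v⟫_ℝ ^ 2 ≤ weightedNormSq A⁻¹ u * weightedNormSq A v := by
  have hu : IsUnit A.det := hA.det_pos.ne'.isUnit
  have hAt : A.transpose = A := by simpa using hA.isHermitian.eq
  -- The quadratic in `s` is `‖v - s A⁻¹u‖_A²`; its discriminant is nonpositive.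
  have key : ∀ s : ℝ, 0 ≤ weightedNormSq A⁻¹ u * (s * s) + (-2 * ⟪u, v⟫_ℝ) * s
      + weightedNormSq A v := by
    intro s
    have h := hA.posSemidef.dotProduct_mulVec_nonneg (v.ofLp - s • A⁻¹.mulVec u.ofLp)
    have h1 : A.mulVec (A⁻¹.mulVec u.ofLp) = u.ofLp := by
      rw [Matrix.mulVec_mulVec, Matrix.mul_nonsing_inv _ hu, Matrix.one_mulVec]
    have h2 : A⁻¹.mulVec u.ofLp ⬝ᵥ A.mulVec v.ofLp = u.ofLp ⬝ᵥ v.ofLp := by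
      rw [Matrix.dotProduct_mulVec, ← Matrix.mulVec_transpose, hAt, h1]
    rw [Matrix.mulVec_sub, Matrix.mulVec_smul, h1] at h
    simp only [star_trivial, sub_dotProduct, dotProduct_sub, smul_dotProduct, dotProduct_smul, h2,
      smul_eq_mul] at h
    rw [dotProduct_comm v.ofLp u.ofLp, dotProduct_comm (A⁻¹.mulVec u.ofLp) u.ofLp] at h
    rw [real_inner_eq_dotProduct]
    unfold weightedNormSq
    linarith
  have h := discrim_le_zero key
  unfold discrim at h
  nlinarith

/-- Each eigenvalue's logarithm lies below the tangent of `log` at `a`. Keeping `a` free lets blocks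
of unequal sizes share one tangent point, so their bounds add up without Jensen's inequality. -/
lemma log_det_le {A : Matrix (Fin p) (Fin p) ℝ} (hA : A.PosDef) {a : ℝ} (ha : 0 < a) :
    Real.log A.det ≤ p * Real.log a + A.trace / a - p := by
  have htr := hA.isHermitian.trace_eq_sum_eigenvalues
  have hdet := hA.isHermitian.det_eq_prod_eigenvalues
  simp only [RCLike.ofReal_real_eq_id, id] at htr hdet
  rw [htr, hdet, Real.log_prod fun i _ => (hA.eigenvalues_pos i).ne']
  have h : ∀ i, Real.log (hA.isHermitian.eigenvalues i)
      ≤ Real.log a + hA.isHermitian.eigenvalues i / a - 1 := by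
    intro i
    have h1 := Real.log_le_sub_one_of_pos (div_pos (hA.eigenvalues_pos i) ha)
    rw [Real.log_div (hA.eigenvalues_pos i).ne' ha.ne'] at h1
    linarith
  refine (Finset.sum_le_sum fun i _ => h i).trans_eq ?_
  simp [Finset.sum_add_distrib, Finset.sum_div]

lemma trace_gramMatrix_le (lam : ℝ) {x : ℕ → EuclideanSpace ℝ (Fin p)} {n : ℕ}
    (hx : ∀ k < n, ‖x k‖ ≤ 1) : (gramMatrix lam x n).trace ≤ n + p * lam := by
  unfold gramMatrix
  rw [Matrix.trace_add, Matrix.trace_sum, Matrix.trace_smul, Matrix.trace_one, Fintype.card_fin,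
    smul_eq_mul, mul_comm lam]
  gcongr
  refine (Finset.sum_le_card_nsmul _ _ 1 fun k hk => ?_).trans_eq (by simp)
  rw [Matrix.trace_vecMulVec, ← real_inner_eq_dotProduct, real_inner_self_eq_norm_sq]
  exact pow_le_one₀ (norm_nonneg _) (hx k (Finset.mem_range.1 hk))

/-- The elliptical potential lemma, with the concave logarithm replaced by its tangent at `a`. -/
lemma sum_log_one_add_leverage_le {lam : ℝ} (hlam : 0 < lam)
    {x : ℕ → EuclideanSpace ℝ (Fin p)} {n : ℕ} (hx : ∀ k < n, ‖x k‖ ≤ 1) {a : ℝ} (ha : 0 < a) :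
    ∑ k ∈ Finset.range n, Real.log (1 + leverage lam x k)
      ≤ p * Real.log (a / lam) + (n + p * lam) / a - p := by
  have htel : ∀ m : ℕ, ∑ k ∈ Finset.range m, Real.log (1 + leverage lam x k)
      = Real.log (gramMatrix lam x m).det - p * Real.log lam := by
    intro m
    induction m with
    | zero => simp [gramMatrix]
    | succ m ih =>
      rw [Finset.sum_range_succ, ih, det_gramMatrix_succ hlam,
        Real.log_mul (gramMatrix_posDef hlam x m).det_pos.ne'
          (by linarith [leverage_nonneg hlam x m])]
      ring
  rw [htel, Real.log_div ha.ne' hlam.ne']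
  have h1 := log_det_le (gramMatrix_posDef hlam x n) ha
  have h2 : (gramMatrix lam x n).trace / a ≤ (n + p * lam) / a := by
    gcongr
    exact trace_gramMatrix_le lam hx
  linarith

/-- On `[0, 1]` the chord of the concave function `log(1 + q)` has slope `log 2 > 2/3`. The constant
`3/2` instead of the customary `2` is what leaves room for the uncovered rounds. -/
lemma min_one_le_log_one_add {q : ℝ} (hq : 0 ≤ q) :
    min 1 q ≤ 3 / 2 * Real.log (1 + q) := by
  rcases le_total q 1 with h | h
  · rw [min_eq_right h]
    have hc := strictConcaveOn_log_Ioi.concaveOn.2 (Set.mem_Ioi.2 one_pos)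
      (Set.mem_Ioi.2 two_pos) (sub_nonneg.2 h) hq (sub_add_cancel 1 q)
    simp only [smul_eq_mul, Real.log_one, mul_zero, zero_add] at hc
    rw [show (1 - q) * 1 + q * 2 = 1 + q by ring] at hc
    nlinarith [Real.log_two_gt_d9]
  · rw [min_eq_left h]
    have h1 : Real.log 2 ≤ Real.log (1 + q) := Real.log_le_log (by norm_num) (by linarith)
    linarith [Real.log_two_gt_d9]

end Potential

/-! ### Splitting the rounds into `d` interleaved blocks -/

/-- The rounds `1, …, T` are the rounds `i + 1 + k d` with `i < d` and `k < (T + d - 1 - i) / d`. -/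
lemma sum_Icc_eq_sum_blocks {M : Type*} [AddCommMonoid M] {d : ℕ} (hd : 0 < d) (f : ℕ → M)
    (T : ℕ) :
    ∑ s ∈ Finset.Icc 1 T, f s
      = ∑ i ∈ Finset.range d, ∑ k ∈ Finset.range ((T + d - 1 - i) / d), f (i + 1 + k * d) := by
  rw [Finset.sum_sigma']
  have hmem : ∀ i k, i < d → (k < (T + d - 1 - i) / d ↔ i + 1 + k * d ≤ T) := by
    intro i k hi
    rw [Nat.lt_iff_add_one_le, Nat.le_div_iff_mul_le hd, Nat.succ_mul]
    omega
  refine Finset.sum_bij' (fun s _ => (⟨(s - 1) % d, (s - 1) / d⟩ : Σ _ : ℕ, ℕ))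
    (fun a _ => a.1 + 1 + a.2 * d) ?_ ?_ ?_ ?_ ?_
  · intro s hs
    rw [Finset.mem_Icc] at hs
    have h1 := Nat.mod_lt (s - 1) hd
    have h2 := Nat.mod_add_div (s - 1) d
    simp only [Finset.mem_sigma, Finset.mem_range]
    rw [hmem _ _ h1]
    refine ⟨h1, ?_⟩
    rw [mul_comm] at h2
    omega
  · rintro ⟨i, k⟩ ha
    simp only [Finset.mem_sigma, Finset.mem_range] at ha
    rw [hmem _ _ ha.1] at ha
    simp only [Finset.mem_Icc]
    omega
  · intro s hs
    rw [Finset.mem_Icc] at hs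
    have h2 := Nat.mod_add_div (s - 1) d
    rw [mul_comm] at h2
    simp only
    omega
  · rintro ⟨i, k⟩ ha
    simp only [Finset.mem_sigma, Finset.mem_range] at ha
    have h : i + 1 + k * d - 1 = i + k * d := by omega
    simp only [h, Nat.add_mul_mod_self_right, Nat.mod_eq_of_lt ha.1, Nat.add_mul_div_right _ _ hd,
      Nat.div_eq_of_lt ha.1, zero_add]
  · intro s hs
    rw [Finset.mem_Icc] at hs
    have h2 := Nat.mod_add_div (s - 1) d
    rw [mul_comm] at h2
    congr 1
    simp only
    omega

lemma sum_block_sizes {d : ℕ} (hd : 0 < d) (T : ℕ) :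
    ∑ i ∈ Finset.range d, (((T + d - 1 - i) / d : ℕ) : ℝ) = T := by
  have h := sum_Icc_eq_sum_blocks hd (fun _ => (1 : ℝ)) T
  simp only [Finset.sum_const, Finset.card_range, Nat.card_Icc, nsmul_eq_mul, mul_one,
    Nat.add_sub_cancel] at h
  exact h.symm

/-! ### Ville's inequality and exponential supermartingales -/

section Ville

variable {Ω : Type*} {m m0 : MeasurableSpace Ω} {μ : Measure Ω}

/-- Ville's inequality for a nonnegative supermartingale, given through its set integrals. -/
lemma mul_measure_exists_le_le_one [IsProbabilityMeasure μ] {H : ℕ → MeasurableSpace Ω}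
    (hH : ∀ n, H n ≤ m0) (hmono : Monotone H) {M : ℕ → Ω → ℝ≥0∞}
    (hM : ∀ n, Measurable[H n] (M n)) (h0 : ∫⁻ ω, M 0 ω ∂μ ≤ 1)
    (hstep : ∀ n A, MeasurableSet[H n] A → ∫⁻ ω in A, M (n + 1) ω ∂μ ≤ ∫⁻ ω in A, M n ω ∂μ)
    (c : ℝ≥0∞) : c * μ {ω | ∃ n, c ≤ M n ω} ≤ 1 := by
  -- `A n` is the event of no crossing strictly before `n`, so `A 0` is everything.
  set A : ℕ → Set Ω := fun n => {ω | ∀ k < n, M k ω < c} with hA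
  have hlt : ∀ k n, k ≤ n → MeasurableSet[H n] {ω | M k ω < c} := fun k n hk =>
    hmono hk _ (measurableSet_lt (hM k) measurable_const)
  have hAsucc : ∀ n, A (n + 1) = A n ∩ {ω | M n ω < c} := by
    intro n
    ext ω
    simp only [hA, Set.mem_ofPred_eq, Set.mem_inter_iff, Nat.forall_lt_succ_right]
  have hAm : ∀ n, MeasurableSet[H n] (A n) := by
    intro n
    induction n with
    | zero => simp [hA]
    | succ n ih =>
      rw [hAsucc]
      exact (hmono n.le_succ _ ih).inter (hlt n _ n.le_succ)
  -- Invariant of the stopped process: on the part of `A n` that crosses at time `n`, the mass of `M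
  -- n` pays for `c` times the measure of that part.
  have hmain : ∀ n, ∫⁻ ω in A n, M n ω ∂μ + c * μ (A n)ᶜ ≤ 1 := by
    intro n
    induction n with
    | zero => simpa [hA] using h0
    | succ n ih =>
      have hAn := hH _ _ (hAm n)
      have hln : MeasurableSet {ω | M n ω < c} := hH _ _ (hlt n n le_rfl)
      have hsplit := lintegral_inter_add_sdiff (μ := μ) (M n) (A n) hln
      have hge : c * μ (A n \ {ω | M n ω < c}) ≤ ∫⁻ ω in A n \ {ω | M n ω < c}, M n ω ∂μ := by
        rw [← setLIntegral_const]
        refine setLIntegral_mono_ae' (hAn.diff hln) (Filter.Eventually.of_forall fun ω hω => ?_)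
        simpa using hω.2
      have hcompl : (A (n + 1))ᶜ ⊆ (A n)ᶜ ∪ (A n \ {ω | M n ω < c}) := by
        rw [hAsucc]
        intro ω hω
        by_cases h : ω ∈ A n
        · exact Or.inr ⟨h, fun h' => hω ⟨h, h'⟩⟩
        · exact Or.inl h
      calc ∫⁻ ω in A (n + 1), M (n + 1) ω ∂μ + c * μ (A (n + 1))ᶜ
          ≤ ∫⁻ ω in A (n + 1), M n ω ∂μ
            + c * (μ (A n)ᶜ + μ (A n \ {ω | M n ω < c})) := by
            refine add_le_add (hstep n _ ?_) ?_
            · rw [hAsucc]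
              exact (hAm n).inter (hlt n n le_rfl)
            · gcongr
              exact (measure_mono hcompl).trans (measure_union_le _ _)
        _ ≤ (∫⁻ ω in A n ∩ {ω | M n ω < c}, M n ω ∂μ
            + ∫⁻ ω in A n \ {ω | M n ω < c}, M n ω ∂μ) + c * μ (A n)ᶜ := by
            rw [hAsucc, mul_add, add_assoc, add_comm (c * μ (A n)ᶜ)]
            gcongr
        _ ≤ 1 := by rwa [hsplit]
  have hUnion : {ω | ∃ n, c ≤ M n ω} = ⋃ n, (A n)ᶜ := by
    ext ω
    simp only [hA, Set.mem_ofPred_eq, Set.mem_iUnion, Set.mem_compl_iff, not_forall, not_lt]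
    exact ⟨fun ⟨n, h⟩ => ⟨n + 1, n, n.lt_succ_self, h⟩, fun ⟨_, n, _, h⟩ => ⟨n, h⟩⟩
  have hmonoA : Monotone fun n => (A n)ᶜ := fun m n hmn =>
    Set.compl_subset_compl.2 fun ω hω k hk => hω k (hk.trans_le hmn)
  rw [hUnion, hmonoA.measure_iUnion, ENNReal.mul_iSup]
  exact iSup_le fun n => le_add_self.trans (hmain n)

/-- A conditional sub-Gaussian bound for deterministic multipliers extends to multipliers that
are measurable with respect to the conditioning `σ`-field. -/
lemma setLIntegral_exp_mul_le (hm : m ≤ m0) {ξ l : Ω → ℝ}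
    (hξ : Measurable ξ) (hl : Measurable[m] l)
    (h : ∀ (c : ℝ) (A : Set Ω), MeasurableSet[m] A →
      ∫⁻ ω in A, ENNReal.ofReal (Real.exp (c * ξ ω - c ^ 2 / 2)) ∂μ ≤ μ A)
    {A : Set Ω} (hA : MeasurableSet[m] A) :
    ∫⁻ ω in A, ENNReal.ofReal (Real.exp (l ω * ξ ω - l ω ^ 2 / 2)) ∂μ ≤ μ A := by
  -- `l` is rounded down to the grid of mesh `1/(n + 1)`. Each of the countably many level sets is
  -- `m`-measurable and carries a constant multiplier; Fatou's lemma removes the rounding.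
  set L : ℕ → Ω → ℝ := fun n ω => (⌊l ω * ((n : ℝ) + 1)⌋ : ℝ) / ((n : ℝ) + 1) with hL
  have hLlim : ∀ ω, Filter.Tendsto (fun n => L n ω) Filter.atTop (nhds (l ω)) := by
    intro ω
    have h1 : Filter.Tendsto (fun n : ℕ => l ω - 1 / ((n : ℝ) + 1)) Filter.atTop
        (nhds (l ω)) := by
      simpa using tendsto_const_nhds.sub (tendsto_one_div_add_atTop_nhds_zero_nat (𝕜 := ℝ))
    refine tendsto_of_tendsto_of_tendsto_of_le_of_le h1 tendsto_const_nhds ?_ ?_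
    · intro n
      have hn : (0 : ℝ) < (n : ℝ) + 1 := by positivity
      simp only [hL]
      rw [le_div_iff₀ hn, sub_mul, one_div, inv_mul_cancel₀ hn.ne']
      exact (Int.sub_one_lt_floor _).le
    · intro n
      have hn : (0 : ℝ) < (n : ℝ) + 1 := by positivity
      simp only [hL]
      rw [div_le_iff₀ hn]
      exact Int.floor_le _
  have hlm : Measurable l := hl.mono hm le_rfl
  have hLm : ∀ n, Measurable (L n) := by
    intro n
    have : Measurable fun ω => l ω * ((n : ℝ) + 1) := hlm.mul_const _
    exact (measurable_from_top.comp this.floor).div_const _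
  have hF : ∀ n, Measurable fun ω =>
      ENNReal.ofReal (Real.exp (L n ω * ξ ω - L n ω ^ 2 / 2)) := by
    intro n
    have := hLm n
    fun_prop
  have hbound : ∀ n, ∫⁻ ω in A, ENNReal.ofReal (Real.exp (L n ω * ξ ω - L n ω ^ 2 / 2)) ∂μ
      ≤ μ A := by
    intro n
    set P : ℤ → Set Ω := fun j => A ∩ {ω | ⌊l ω * ((n : ℝ) + 1)⌋ = j} with hP
    have hPm : ∀ j, MeasurableSet[m] (P j) := by
      intro j
      have h1 : Measurable[m] fun ω => l ω * ((n : ℝ) + 1) := hl.mul_const _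
      exact hA.inter ((Int.measurable_floor.comp h1) (measurableSet_singleton j))
    have hdisj : Pairwise (Function.onFun Disjoint P) := by
      intro i j hij
      refine Set.disjoint_left.2 fun ω h1 h2 => hij ?_
      exact h1.2.symm.trans h2.2
    have hAU : A = ⋃ j, P j := by
      ext ω
      simp [hP]
    conv_lhs => rw [hAU]
    conv_rhs => rw [hAU]
    rw [lintegral_iUnion (fun j => hm _ (hPm j)) hdisj,
      measure_iUnion hdisj (fun j => hm _ (hPm j))]
    refine ENNReal.tsum_le_tsum fun j => ?_
    refine le_trans (le_of_eq ?_) (h ((j : ℝ) / ((n : ℝ) + 1)) (P j) (hPm j))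
    refine setLIntegral_congr_fun (hm _ (hPm j)) fun ω hω => ?_
    have : L n ω = (j : ℝ) / ((n : ℝ) + 1) := by
      simp only [hL]
      rw [hω.2]
    simp only [this]
  have hlim : ∀ ω, Filter.liminf
      (fun n => ENNReal.ofReal (Real.exp (L n ω * ξ ω - L n ω ^ 2 / 2))) Filter.atTop
      = ENNReal.ofReal (Real.exp (l ω * ξ ω - l ω ^ 2 / 2)) := by
    intro ω
    refine Filter.Tendsto.liminf_eq (ENNReal.tendsto_ofReal ?_)
    exact (Real.continuous_exp.tendsto _).comp
      (((hLlim ω).mul_const _).sub (((hLlim ω).pow 2).div_const _))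
  calc ∫⁻ ω in A, ENNReal.ofReal (Real.exp (l ω * ξ ω - l ω ^ 2 / 2)) ∂μ
      = ∫⁻ ω in A, Filter.liminf
        (fun n => ENNReal.ofReal (Real.exp (L n ω * ξ ω - L n ω ^ 2 / 2))) Filter.atTop ∂μ := by
        simp only [hlim]
    _ ≤ _ := lintegral_liminf_le hF
    _ ≤ μ A := Filter.liminf_le_of_frequently_le' (Filter.Frequently.of_forall hbound)

/-- The hypothesis says that the measure with density `F` is dominated by `μ` on `m`, hence so are
the integrals of `m`-measurable functions. -/
lemma lintegral_mul_le_of_setLIntegral_le (hm : m ≤ m0)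
    {Z F : Ω → ℝ≥0∞} (hZ : Measurable[m] Z) (hF : Measurable F)
    (h : ∀ A, MeasurableSet[m] A → ∫⁻ ω in A, F ω ∂μ ≤ μ A) :
    ∫⁻ ω, Z ω * F ω ∂μ ≤ ∫⁻ ω, Z ω ∂μ := by
  have hZ0 : Measurable Z := hZ.mono hm le_rfl
  have hle : (μ.withDensity F).trim hm ≤ μ.trim hm := by
    refine Measure.le_iff.2 fun A hA => ?_
    rw [trim_measurableSet_eq hm hA, trim_measurableSet_eq hm hA, withDensity_apply _ (hm _ hA)]
    exact h A hA
  calc ∫⁻ ω, Z ω * F ω ∂μ = ∫⁻ ω, Z ω ∂(μ.withDensity F) := by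
        rw [lintegral_withDensity_eq_lintegral_mul μ hF hZ0]
        simp [mul_comm]
    _ = ∫⁻ ω, Z ω ∂((μ.withDensity F).trim hm) := (lintegral_trim hm hZ).symm
    _ ≤ ∫⁻ ω, Z ω ∂(μ.trim hm) := lintegral_mono' hle le_rfl
    _ = ∫⁻ ω, Z ω ∂μ := lintegral_trim hm hZ

lemma setLIntegral_exp_le_of_condExp_le [IsFiniteMeasure μ] (hm : m ≤ m0)
    {ξ : Ω → ℝ} {c : ℝ} (hint : Integrable (fun ω => Real.exp (c * ξ ω)) μ)
    (h : ∀ᵐ ω ∂μ, (μ[fun ω => Real.exp (c * ξ ω) | m]) ω ≤ Real.exp (c ^ 2 / 2))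
    {A : Set Ω} (hA : MeasurableSet[m] A) :
    ∫⁻ ω in A, ENNReal.ofReal (Real.exp (c * ξ ω - c ^ 2 / 2)) ∂μ ≤ μ A := by
  have hA0 := hm _ hA
  have h1 : ∫ ω in A, Real.exp (c * ξ ω) ∂μ ≤ Real.exp (c ^ 2 / 2) * μ.real A := by
    rw [← setIntegral_condExp hm hint hA]
    calc ∫ ω in A, (μ[fun ω => Real.exp (c * ξ ω) | m]) ω ∂μ
        ≤ ∫ _ in A, Real.exp (c ^ 2 / 2) ∂μ :=
          integral_mono_ae integrable_condExp.integrableOn (integrable_const _)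
            (ae_restrict_of_ae h)
      _ = _ := by rw [setIntegral_const, smul_eq_mul, mul_comm]
  simp only [sub_eq_add_neg, Real.exp_add]
  rw [← ofReal_integral_eq_lintegral_ofReal (hint.integrableOn.mul_const _)
    (Filter.Eventually.of_forall fun ω => by positivity), integral_mul_const,
    ← ofReal_measureReal]
  refine ENNReal.ofReal_le_ofReal ?_
  rw [Real.exp_neg, ← div_eq_mul_inv, div_le_iff₀ (Real.exp_pos _), mul_comm]
  exact h1

end Ville

/-! ### The method of mixtures -/

section Mixture

variable {p : ℕ}

/-- The logarithm of the likelihood ratio of the parameter shift `v` under unit Gaussian noise. -/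
def logRatio (x : ℕ → EuclideanSpace ℝ (Fin p)) (ξ : ℕ → ℝ) (n : ℕ)
    (v : EuclideanSpace ℝ (Fin p)) : ℝ :=
  ∑ k ∈ Finset.range n, (⟪v, x k⟫_ℝ * ξ k - ⟪v, x k⟫_ℝ ^ 2 / 2)

/-- The likelihood ratio against `θ₀`, mixed over a prior. -/
def mixture (π : Measure (EuclideanSpace ℝ (Fin p))) (θ₀ : EuclideanSpace ℝ (Fin p))
    (x : ℕ → EuclideanSpace ℝ (Fin p)) (ξ : ℕ → ℝ) (n : ℕ) : ℝ≥0∞ :=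
  ∫⁻ θ, ENNReal.ofReal (Real.exp (logRatio x ξ n (θ - θ₀))) ∂π

lemma measurable_logRatio {Ω : Type*} [MeasurableSpace Ω] {n : ℕ}
    {x : ℕ → Ω → EuclideanSpace ℝ (Fin p)} {ξ : ℕ → Ω → ℝ} (hx : ∀ k < n, Measurable (x k))
    (hξ : ∀ k < n, Measurable (ξ k)) (θ₀ : EuclideanSpace ℝ (Fin p)) :
    Measurable fun z : Ω × EuclideanSpace ℝ (Fin p) =>
      logRatio (fun k => x k z.1) (fun k => ξ k z.1) n (z.2 - θ₀) := by
  unfold logRatio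
  refine Finset.measurable_sum _ fun k hk => ?_
  have h1 := hx k (Finset.mem_range.1 hk)
  have h2 := hξ k (Finset.mem_range.1 hk)
  have h3 : Measurable fun z : Ω × EuclideanSpace ℝ (Fin p) => ⟪z.2 - θ₀, x k z.1⟫_ℝ :=
    (measurable_snd.sub_const _).inner (h1.comp measurable_fst)
  exact (h3.mul (h2.comp measurable_fst)).sub ((h3.pow_const 2).div_const 2)

lemma measurable_mixture {Ω : Type*} [MeasurableSpace Ω] {n : ℕ}
    {x : ℕ → Ω → EuclideanSpace ℝ (Fin p)} {ξ : ℕ → Ω → ℝ} (hx : ∀ k < n, Measurable (x k))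
    (hξ : ∀ k < n, Measurable (ξ k)) (θ₀ : EuclideanSpace ℝ (Fin p))
    (π : Measure (EuclideanSpace ℝ (Fin p))) [SFinite π] :
    Measurable fun ω => mixture π θ₀ (fun k => x k ω) (fun k => ξ k ω) n :=
  Measurable.lintegral_prod_right'
    (f := fun z : Ω × EuclideanSpace ℝ (Fin p) =>
      ENNReal.ofReal (Real.exp (logRatio (fun k => x k z.1) (fun k => ξ k z.1) n (z.2 - θ₀))))
    (Real.measurable_exp.comp (measurable_logRatio hx hξ θ₀)).ennreal_ofReal

/-- Ville's inequality for the mixture of exponential supermartingales. -/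
lemma mul_measure_exists_le_mixture_le_one {Ω : Type*} {m0 : MeasurableSpace Ω} {μ : Measure Ω}
    [IsProbabilityMeasure μ] {H : ℕ → MeasurableSpace Ω} (hH : ∀ n, H n ≤ m0)
    (hmono : Monotone H) {x : ℕ → Ω → EuclideanSpace ℝ (Fin p)} {ξ : ℕ → Ω → ℝ}
    (hx : ∀ n, Measurable[H n] (x n)) (hξ : ∀ n, Measurable[H (n + 1)] (ξ n))
    (hsub : ∀ (n : ℕ) (c : ℝ) (A : Set Ω), MeasurableSet[H n] A →
      ∫⁻ ω in A, ENNReal.ofReal (Real.exp (c * ξ n ω - c ^ 2 / 2)) ∂μ ≤ μ A)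
    (π : Measure (EuclideanSpace ℝ (Fin p))) [IsProbabilityMeasure π]
    (θ₀ : EuclideanSpace ℝ (Fin p)) (c : ℝ≥0∞) :
    c * μ {ω | ∃ n, c ≤ mixture π θ₀ (fun k => x k ω) (fun k => ξ k ω) n} ≤ 1 := by
  have hxn : ∀ n, ∀ k < n, Measurable[H n] (x k) := fun n k hk => (hx k).mono (hmono hk.le) le_rfl
  have hξn : ∀ n, ∀ k < n, Measurable[H n] (ξ k) := fun n k hk =>
    (hξ k).mono (hmono (Nat.succ_le_of_lt hk)) le_rfl
  have hx0 : ∀ k, Measurable (x k) := fun k => (hx k).mono (hH k) le_rfl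
  have hξ0 : ∀ k, Measurable (ξ k) := fun k => (hξ k).mono (hH _) le_rfl
  have hjoint : ∀ n, Measurable fun z : Ω × EuclideanSpace ℝ (Fin p) => ENNReal.ofReal
      (Real.exp (logRatio (fun k => x k z.1) (fun k => ξ k z.1) n (z.2 - θ₀))) := fun n =>
    (Real.measurable_exp.comp (measurable_logRatio (fun k _ => hx0 k) (fun k _ => hξ0 k)
      θ₀)).ennreal_ofReal
  refine mul_measure_exists_le_le_one hH hmono (fun n => ?_) ?_ ?_ c
  · let _ := H n
    exact measurable_mixture (hxn n) (hξn n) θ₀ π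
  · simp [mixture, logRatio]
  · intro n A hA
    have hA0 := hH n _ hA
    unfold mixture
    -- By Tonelli the supermartingale step need only be checked for each fixed `θ`. Below, `Z` is
    -- the part known at time `n`, including the indicator of `A`, and `F` is the new factor.
    refine (lintegral_lintegral_swap (hjoint (n + 1)).aemeasurable).trans_le
      (le_trans (lintegral_mono fun θ => ?_)
        (lintegral_lintegral_swap (hjoint n).aemeasurable).symm.le)
    set Z : Ω → ℝ≥0∞ := A.indicator fun ω => ENNReal.ofReal
      (Real.exp (logRatio (fun k => x k ω) (fun k => ξ k ω) n (θ - θ₀))) with hZ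
    set F : Ω → ℝ≥0∞ := fun ω => ENNReal.ofReal
      (Real.exp (⟪θ - θ₀, x n ω⟫_ℝ * ξ n ω - ⟪θ - θ₀, x n ω⟫_ℝ ^ 2 / 2)) with hF
    have hZm : Measurable[H n] Z := by
      let _ := H n
      refine Measurable.indicator ?_ hA
      exact (Real.measurable_exp.comp ((measurable_logRatio (hxn n) (hξn n) θ₀).comp
        (measurable_id.prodMk measurable_const))).ennreal_ofReal
    have hlm : Measurable[H n] fun ω => ⟪θ - θ₀, x n ω⟫_ℝ := by
      let _ := H n
      exact measurable_const.inner (hx n)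
    have hl0 : Measurable fun ω => ⟪θ - θ₀, x n ω⟫_ℝ := hlm.mono (hH n) le_rfl
    have hFm : Measurable F :=
      (Real.measurable_exp.comp ((hl0.mul (hξ0 n)).sub
        ((hl0.pow_const 2).div_const 2))).ennreal_ofReal
    have h := lintegral_mul_le_of_setLIntegral_le (hH n) hZm hFm fun A' hA' =>
      setLIntegral_exp_mul_le (hH n) (hξ0 n) hlm (hsub n) hA'
    calc ∫⁻ ω in A, ENNReal.ofReal
          (Real.exp (logRatio (fun k => x k ω) (fun k => ξ k ω) (n + 1) (θ - θ₀))) ∂μ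
        = ∫⁻ ω, Z ω * F ω ∂μ := by
          rw [← lintegral_indicator hA0]
          congr 1 with ω
          by_cases hω : ω ∈ A
          · simp only [hZ, hF, Set.indicator_of_mem hω, logRatio, Finset.sum_range_succ,
              Real.exp_add]
            rw [ENNReal.ofReal_mul (Real.exp_nonneg _)]
          · simp [hZ, Set.indicator_of_notMem hω]
      _ ≤ ∫⁻ ω, Z ω ∂μ := h
      _ = _ := by rw [hZ, lintegral_indicator hA0]

/-- The log ratio is a concave quadratic: averaging over `±v` cancels the linear part in `v` and
leaves a loss of at most `n‖v‖²/2`. -/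
lemma logRatio_reflect {x : ℕ → EuclideanSpace ℝ (Fin p)} (ξ : ℕ → ℝ) {n : ℕ}
    (hx : ∀ k < n, ‖x k‖ ≤ 1) (u v : EuclideanSpace ℝ (Fin p)) :
    2 * (logRatio x ξ n u - n * ‖v‖ ^ 2 / 2)
      ≤ logRatio x ξ n (u + v) + logRatio x ξ n (u - v) := by
  have h : ∑ k ∈ Finset.range n, ⟪v, x k⟫_ℝ ^ 2 ≤ n * ‖v‖ ^ 2 := by
    refine (Finset.sum_le_card_nsmul _ _ (‖v‖ ^ 2) fun k hk => ?_).trans_eq (by simp)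
    rw [← sq_abs]
    have h1 := abs_real_inner_le_norm v (x k)
    have h2 := hx k (Finset.mem_range.1 hk)
    gcongr
    exact h1.trans (mul_le_of_le_one_right (norm_nonneg _) h2)
  have heq : logRatio x ξ n (u + v) + logRatio x ξ n (u - v)
      = 2 * logRatio x ξ n u - ∑ k ∈ Finset.range n, ⟪v, x k⟫_ℝ ^ 2 := by
    unfold logRatio
    rw [← Finset.sum_add_distrib, Finset.mul_sum, ← Finset.sum_sub_distrib]
    refine Finset.sum_congr rfl fun k _ => ?_
    rw [inner_add_left, inner_sub_left]
    ring
  rw [heq]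
  linarith

/-- The mixture over the uniform prior on a ball dominates the likelihood ratio of each parameter
that lies well inside the ball, up to the volume ratio and a smoothing cost. -/
lemma le_mixture_uniform {r ρ : ℝ} (hρ : 0 < ρ) {x : ℕ → EuclideanSpace ℝ (Fin p)} (ξ : ℕ → ℝ)
    {n : ℕ} (hx : ∀ k < n, ‖x k‖ ≤ 1) (θ₀ θ : EuclideanSpace ℝ (Fin p)) (hθ : ‖θ‖ + ρ ≤ r) :
    ENNReal.ofReal ((ρ / r) ^ p * Real.exp (logRatio x ξ n (θ - θ₀) - n * ρ ^ 2 / 2))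
      ≤ mixture (cond volume (Metric.closedBall 0 r)) θ₀ x ξ n := by
  have hr : 0 < r := by linarith [norm_nonneg θ]
  set f : EuclideanSpace ℝ (Fin p) → ℝ≥0∞ := fun η =>
    ENNReal.ofReal (Real.exp (logRatio x ξ n (η - θ₀))) with hf
  have hfm : Measurable f := by
    have h := measurable_logRatio (Ω := Unit) (x := fun k _ => x k) (ξ := fun k _ => ξ k) (n := n)
      (fun _ _ => measurable_const) (fun _ _ => measurable_const) θ₀
    exact (Real.measurable_exp.comp (h.comp (measurable_const (a := ()).prodMk
      measurable_id))).ennreal_ofReal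
  set a : ℝ := logRatio x ξ n (θ - θ₀) - n * ρ ^ 2 / 2 with ha
  -- The point reflection at `θ` preserves volume and the small ball, so `f` may be averaged with
  -- its mirror image; AM-GM then reduces the average to `logRatio_reflect`.
  have hrefl : ∫⁻ η in Metric.closedBall θ ρ, f ((θ + θ) - η)
      = ∫⁻ η in Metric.closedBall θ ρ, f η := by
    have h := (Measure.measurePreserving_sub_left (volume : Measure (EuclideanSpace ℝ (Fin p)))
      (θ + θ)).setLIntegral_comp_preimage (Metric.isClosed_closedBall (x := θ)
        (ε := ρ)).measurableSet hfm
    rw [← h]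
    congr 2
    ext η
    simp only [Metric.mem_closedBall, Set.mem_preimage, dist_eq_norm]
    rw [show θ + θ - η - θ = -(η - θ) by abel, norm_neg]
  have hpt : ∀ η ∈ Metric.closedBall θ ρ,
      2 * ENNReal.ofReal (Real.exp a) ≤ f η + f ((θ + θ) - η) := by
    intro η hη
    have hv : ‖η - θ‖ ≤ ρ := by simpa [dist_eq_norm] using hη
    have h1 := logRatio_reflect ξ hx (θ - θ₀) (η - θ)
    rw [show θ - θ₀ + (η - θ) = η - θ₀ by abel,
      show θ - θ₀ - (η - θ) = θ + θ - η - θ₀ by abel] at h1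
    have h2 : n * ‖η - θ‖ ^ 2 / 2 ≤ n * ρ ^ 2 / 2 := by gcongr
    set s := logRatio x ξ n (η - θ₀) with hs
    set t := logRatio x ξ n (θ + θ - η - θ₀) with ht
    have h3 : 2 * Real.exp a ≤ Real.exp s + Real.exp t := by
      have hle : Real.exp a ≤ Real.exp ((s + t) / 2) := Real.exp_le_exp.2 (by linarith)
      have hs2 : Real.exp s = Real.exp (s / 2) ^ 2 := by
        rw [← Real.exp_nat_mul]
        congr 1
        push_cast
        ring
      have ht2 : Real.exp t = Real.exp (t / 2) ^ 2 := by
        rw [← Real.exp_nat_mul]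
        congr 1
        push_cast
        ring
      have hst : Real.exp ((s + t) / 2) = Real.exp (s / 2) * Real.exp (t / 2) := by
        rw [← Real.exp_add]
        congr 1
        ring
      nlinarith [sq_nonneg (Real.exp (s / 2) - Real.exp (t / 2))]
    calc 2 * ENNReal.ofReal (Real.exp a) = ENNReal.ofReal (2 * Real.exp a) := by
          rw [ENNReal.ofReal_mul (by norm_num)]
          simp
      _ ≤ ENNReal.ofReal (Real.exp s + Real.exp t) := ENNReal.ofReal_le_ofReal h3
      _ = f η + f ((θ + θ) - η) :=
          ENNReal.ofReal_add (Real.exp_nonneg _) (Real.exp_nonneg _)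
  have hball : ENNReal.ofReal (Real.exp a) * volume (Metric.closedBall θ ρ)
      ≤ ∫⁻ η in Metric.closedBall θ ρ, f η := by
    have h2 : 2 * (ENNReal.ofReal (Real.exp a) * volume (Metric.closedBall θ ρ))
        ≤ 2 * ∫⁻ η in Metric.closedBall θ ρ, f η := by
      calc 2 * (ENNReal.ofReal (Real.exp a) * volume (Metric.closedBall θ ρ))
          = ∫⁻ _ in Metric.closedBall θ ρ, 2 * ENNReal.ofReal (Real.exp a) := by
            rw [setLIntegral_const, mul_assoc]
        _ ≤ ∫⁻ η in Metric.closedBall θ ρ, (f η + f ((θ + θ) - η)) :=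
            setLIntegral_mono_ae' Metric.isClosed_closedBall.measurableSet
              (Filter.Eventually.of_forall hpt)
        _ = 2 * ∫⁻ η in Metric.closedBall θ ρ, f η := by
            rw [lintegral_add_left hfm, hrefl, two_mul]
    exact (ENNReal.mul_le_mul_iff_right (by norm_num) (by norm_num)).1 h2
  have hsub : Metric.closedBall θ ρ ⊆ Metric.closedBall 0 r := by
    refine Metric.closedBall_subset_closedBall' ?_
    rw [dist_zero_right]
    linarith
  have hvol : ENNReal.ofReal ((ρ / r) ^ p) * volume (Metric.closedBall
      (0 : EuclideanSpace ℝ (Fin p)) r) = volume (Metric.closedBall θ ρ) := by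
    rw [Measure.addHaar_closedBall _ _ hr.le, Measure.addHaar_closedBall _ _ hρ.le, ← mul_assoc,
      ← ENNReal.ofReal_mul (by positivity), finrank_euclideanSpace_fin, ← mul_pow,
      div_mul_cancel₀ _ hr.ne']
  have hV0 : volume (Metric.closedBall (0 : EuclideanSpace ℝ (Fin p)) r) ≠ 0 :=
    (Metric.measure_closedBall_pos _ _ hr).ne'
  have hVt : volume (Metric.closedBall (0 : EuclideanSpace ℝ (Fin p)) r) ≠ ⊤ :=
    measure_closedBall_lt_top.ne
  unfold mixture
  rw [ProbabilityTheory.cond, lintegral_smul_measure, smul_eq_mul]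
  calc ENNReal.ofReal ((ρ / r) ^ p * Real.exp a)
      = (volume (Metric.closedBall (0 : EuclideanSpace ℝ (Fin p)) r))⁻¹
        * (ENNReal.ofReal (Real.exp a) * volume (Metric.closedBall θ ρ)) := by
        rw [← hvol, ENNReal.ofReal_mul (by positivity)]
        rw [show ∀ A B V W : ℝ≥0∞, W * (B * (A * V)) = (W * V) * (A * B) by intros; ring]
        rw [ENNReal.inv_mul_cancel hV0 hVt, one_mul]
    _ ≤ _ := by
        gcongr
        exact hball.trans (lintegral_mono_set hsub)

end Mixture

/-! ### The noise given the delayed past -/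

section Noise

lemma noiseSigma_mono {Ω : Type*} (ε : ℕ → Ω → ℝ) : Monotone (noiseSigma ε) := by
  intro s t hst
  unfold noiseSigma
  exact biSup_mono fun i hi => Finset.Icc_subset_Icc_right hst hi

lemma noiseSigma_zero {Ω : Type*} (ε : ℕ → Ω → ℝ) : noiseSigma ε 0 = ⊥ := by
  simp [noiseSigma]

lemma measurable_noiseSigma {Ω : Type*} (ε : ℕ → Ω → ℝ) {t : ℕ} (ht : 1 ≤ t) :
    Measurable[noiseSigma ε t] (ε t) := by
  refine measurable_iff_comap_le.2 ?_
  exact le_biSup (fun s => MeasurableSpace.comap (ε s) (borel ℝ)) (Finset.mem_Icc.2 ⟨ht, le_rfl⟩)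

variable {Ω : Type*} [m0 : MeasurableSpace Ω] {μ : Measure Ω} {ε : ℕ → Ω → ℝ} {φ : ℕ → ℝ}

/-- The conditional mean of `ε_t` given the noise up to round `t - d`. -/
def noiseBias (μ : Measure Ω) (ε : ℕ → Ω → ℝ) (d t : ℕ) : Ω → ℝ :=
  μ[ε t | noiseSigma ε (t - d)]

lemma IsMixingSubGaussian.noiseSigma_le {σ : ℝ≥0} (hε : IsMixingSubGaussian μ σ φ ε) (t : ℕ) :
    noiseSigma ε t ≤ m0 := by
  unfold noiseSigma
  refine iSup₂_le fun s hs => ?_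
  exact measurable_iff_comap_le.1 (hε.measurable s (Finset.mem_Icc.1 hs).1)

lemma measurable_noiseBias (ε : ℕ → Ω → ℝ) (d t : ℕ) :
    Measurable[noiseSigma ε (t - d)] (noiseBias μ ε d t) :=
  stronglyMeasurable_condExp.measurable

lemma measurable_sub_noiseBias (ε : ℕ → Ω → ℝ) (d : ℕ) {t : ℕ} (ht : 1 ≤ t) :
    Measurable[noiseSigma ε t] fun ω => ε t ω - noiseBias μ ε d t ω :=
  (measurable_noiseSigma ε ht).sub
    ((measurable_noiseBias ε d t).mono (noiseSigma_mono ε (Nat.sub_le t d)) le_rfl)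

/-- Truncated subtraction makes `t - d` equal to `0` here, and conditioning on the trivial field
gives the mean. The first `d` rounds thus fit the same scheme as the later ones. -/
lemma IsMixingSubGaussian.noiseBias_eq_zero [IsProbabilityMeasure μ] {σ : ℝ≥0}
    (hε : IsMixingSubGaussian μ σ φ ε) {d t : ℕ} (ht : 1 ≤ t) (htd : t ≤ d) :
    noiseBias μ ε d t = 0 := by
  funext ω
  rw [noiseBias, Nat.sub_eq_zero_of_le htd, noiseSigma_zero, condExp_bot, hε.centred t ht]
  rfl

lemma IsMixingSubGaussian.abs_noiseBias_le [IsProbabilityMeasure μ] {σ : ℝ≥0}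
    (hε : IsMixingSubGaussian μ σ φ ε) {d t : ℕ} (hd : 0 < d) (ht : 1 ≤ t) :
    ∀ᵐ ω ∂μ, |noiseBias μ ε d t ω| ≤ φ d := by
  rcases lt_or_ge d t with h | h
  · exact hε.condMean_le d t hd h
  · rw [hε.noiseBias_eq_zero ht h]
    simp [hε.phi_nonneg d]

lemma IsMixingSubGaussian.setLIntegral_exp_le [IsProbabilityMeasure μ]
    (hε : IsMixingSubGaussian μ 1 φ ε) {d t : ℕ} (hd : 0 < d) (ht : 1 ≤ t) (c : ℝ) {A : Set Ω}
    (hA : MeasurableSet[noiseSigma ε (t - d)] A) :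
    ∫⁻ ω in A, ENNReal.ofReal (Real.exp (c * (ε t ω - noiseBias μ ε d t ω) - c ^ 2 / 2)) ∂μ
      ≤ μ A := by
  have hm := hε.noiseSigma_le (t - d)
  have hsg := hε.subGaussian t ht
  refine setLIntegral_exp_le_of_condExp_le hm ?_ ?_ hA
  · have hb : Measurable (noiseBias μ ε d t) := (measurable_noiseBias ε d t).mono hm le_rfl
    have hmeas : Measurable (ε t) := hε.measurable t ht
    -- Integrability is needed because the conditional expectation of a non-integrable function
    -- defaults to `0`, and a bound on it would carry no information.
    refine ((hsg.integrable_exp_mul c).const_mul (Real.exp (|c| * φ d))).mono'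
      (by fun_prop) ?_
    filter_upwards [hε.abs_noiseBias_le hd ht] with ω hω
    rw [Real.norm_eq_abs, Real.abs_exp, ← Real.exp_add]
    refine Real.exp_le_exp.2 ?_
    have h1 : -(c * noiseBias μ ε d t ω) ≤ |c| * φ d :=
      (neg_le_abs _).trans (by rw [abs_mul]; gcongr)
    linarith
  · rcases lt_or_ge d t with h | h
    · filter_upwards [hε.condSubGaussian d t hd h c] with ω hω
      simpa [noiseBias] using hω
    · rw [hε.noiseBias_eq_zero ht h, Nat.sub_eq_zero_of_le h, noiseSigma_zero, condExp_bot]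
      refine Filter.Eventually.of_forall fun _ => ?_
      have h1 := hsg.mgf_le c
      simpa [mgf] using h1

end Noise

/-! ### The confidence event -/

/-- The part of the squared confidence radius that accounts for the centred noise. -/
def noiseRadiusSq (p d : ℕ) (B δ : ℝ) (t : ℕ) : ℝ :=
  (d * p : ℝ) * Real.log ((B + 1) ^ 2 * Real.exp 1 * max (d * p : ℝ) (t + d : ℝ) / (d * p : ℝ))
    + 2 * d * Real.log (d / δ)

lemma betaSq_eq (p d : ℕ) {B : ℝ} (hB : 0 < B) (δ : ℝ) (φ : ℕ → ℝ) (t : ℕ) :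
    betaSq p d B (1 / B ^ 2) δ φ t = noiseRadiusSq p d B δ t + 4 + 2 * t * φ d * (B + 1) := by
  unfold betaSq noiseRadiusSq
  field_simp
  ring

lemma noiseRadiusSq_mono {p d : ℕ} (hp : 0 < p) (hd : 0 < d) {B : ℝ} (hB : 0 < B) (δ : ℝ) :
    Monotone (noiseRadiusSq p d B δ) := by
  intro s t hst
  have hdp : (0 : ℝ) < d * p := by positivity
  have hst' : (s : ℝ) ≤ t := by exact_mod_cast hst
  have hpos : (0 : ℝ) < max (d * p : ℝ) (s + d : ℝ) := lt_max_of_lt_left hdp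
  unfold noiseRadiusSq
  gcongr

lemma noiseRadiusSq_nonneg {p d : ℕ} (hp : 0 < p) (hd : 0 < d) {B : ℝ} (hB : 0 < B) {δ : ℝ}
    (hδ0 : 0 < δ) (hδ1 : δ < 1) (t : ℕ) : 0 ≤ noiseRadiusSq p d B δ t := by
  have hdp : (0 : ℝ) < d * p := by positivity
  have hd1 : (1 : ℝ) ≤ d := by exact_mod_cast hd
  unfold noiseRadiusSq
  have h1 : 0 ≤ Real.log ((B + 1) ^ 2 * Real.exp 1 * max (d * p : ℝ) (t + d : ℝ) / (d * p : ℝ)) := by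
    refine Real.log_nonneg ?_
    rw [le_div_iff₀ hdp, one_mul]
    have h2 : (1 : ℝ) ≤ (B + 1) ^ 2 * Real.exp 1 :=
      one_le_mul_of_one_le_of_one_le (one_le_pow₀ (by linarith)) (Real.one_le_exp (by norm_num))
    calc (d * p : ℝ) ≤ max (d * p : ℝ) (t + d : ℝ) := le_max_left _ _
      _ ≤ _ := le_mul_of_one_le_left (hdp.le.trans (le_max_left _ _)) h2
  have h2 : 0 ≤ Real.log (d / δ) := by
    refine Real.log_nonneg ?_
    rw [le_div_iff₀ hδ0]
    linarith
  positivity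

/-- Mixture bounds in the `d` interleaved blocks of rounds bound the likelihood ratio of all the
rounds. -/
lemma two_mul_sum_sub_le_noiseRadiusSq {p d : ℕ} (hp : 0 < p) (hd : 0 < d) {B : ℝ} (hB : 0 < B)
    {δ : ℝ} (hδ0 : 0 < δ) {x : ℕ → EuclideanSpace ℝ (Fin p)} (hx : ∀ t, 1 ≤ t → ‖x t‖ ≤ 1)
    {ξ : ℕ → ℝ} {θstar : EuclideanSpace ℝ (Fin p)}
    (hmix : ∀ i < d, ∀ n, mixture (cond volume (Metric.closedBall 0 (B + 1))) θstar
      (fun k => x (i + 1 + k * d)) (fun k => ξ (i + 1 + k * d)) n < ENNReal.ofReal (d / δ))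
    (t : ℕ) {θ : EuclideanSpace ℝ (Fin p)} (hθ : ‖θ‖ ≤ B) :
    2 * ∑ s ∈ Finset.Icc 1 t, ⟪θ - θstar, x s⟫_ℝ * ξ s
      - ∑ s ∈ Finset.Icc 1 t, ⟪θ - θstar, x s⟫_ℝ ^ 2 ≤ noiseRadiusSq p d B δ t := by
  have hdp : (0 : ℝ) < d * p := by positivity
  have hdδ : (0 : ℝ) < d / δ := by positivity
  set m : ℝ := max (d * p : ℝ) (t + d : ℝ) with hm
  have hm0 : 0 < m := lt_max_of_lt_left hdp
  -- The smoothing radius balances volume against smoothing: `ρ ≤ 1` keeps the small ball inside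
  -- radius `B + 1`, and `tρ² ≤ dp` is the cost absorbed by the factor `e` in the logarithm.
  set ρ : ℝ := Real.sqrt (d * p / m) with hρdef
  have hρ2 : ρ ^ 2 = d * p / m := Real.sq_sqrt (by positivity)
  have hρ : 0 < ρ := Real.sqrt_pos.2 (by positivity)
  have hρ1 : ρ ≤ 1 := Real.sqrt_le_one.2 ((div_le_one hm0).2 (le_max_left _ _))
  set N : ℕ → ℕ := fun i => (t + d - 1 - i) / d with hN
  have hblock : ∀ i ∈ Finset.range d,
      logRatio (fun k => x (i + 1 + k * d)) (fun k => ξ (i + 1 + k * d)) (N i) (θ - θstar)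
        ≤ Real.log (d / δ) - p * Real.log (ρ / (B + 1)) + N i * ρ ^ 2 / 2 := by
    intro i hi
    have h := (le_mixture_uniform (r := B + 1) hρ (fun k => ξ (i + 1 + k * d)) (n := N i)
      (fun k _ => hx (i + 1 + k * d) (by omega)) θstar θ (by linarith)).trans_lt
      (hmix i (Finset.mem_range.1 hi) (N i))
    rw [ENNReal.ofReal_lt_ofReal_iff hdδ] at h
    have hρB : 0 < ρ / (B + 1) := by positivity
    have h2 := Real.log_lt_log (by positivity) h
    rw [Real.log_mul (by positivity) (Real.exp_pos _).ne', Real.log_exp, Real.log_pow] at h2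
    linarith
  have hcount : ∑ i ∈ Finset.range d, (N i : ℝ) = t := sum_block_sizes hd t
  have hsum := Finset.sum_le_sum hblock
  unfold logRatio at hsum
  rw [← sum_Icc_eq_sum_blocks hd
    (fun s => ⟪θ - θstar, x s⟫_ℝ * ξ s - ⟪θ - θstar, x s⟫_ℝ ^ 2 / 2) t,
    Finset.sum_sub_distrib, ← Finset.sum_div, Finset.sum_add_distrib, ← Finset.sum_div,
    ← Finset.sum_mul, hcount, Finset.sum_const, Finset.card_range, nsmul_eq_mul,
    Real.log_div hρ.ne' (by positivity)] at hsum
  have hlogρ : 2 * Real.log ρ = Real.log (d * p) - Real.log m := by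
    rw [← Real.log_div hdp.ne' hm0.ne', ← hρ2, Real.log_pow]
    norm_num
  have htm : t * ρ ^ 2 ≤ d * p := by
    rw [hρ2, mul_div_assoc', div_le_iff₀ hm0, mul_comm]
    have : (t : ℝ) ≤ m := le_trans (by linarith [(Nat.cast_nonneg d : (0 : ℝ) ≤ d)])
      (le_max_right _ _)
    gcongr
  have hlog : Real.log ((B + 1) ^ 2 * Real.exp 1 * m / (d * p : ℝ))
      = 2 * Real.log (B + 1) + 1 - 2 * Real.log ρ := by
    rw [Real.log_div (by positivity) hdp.ne', Real.log_mul (by positivity) hm0.ne',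
      Real.log_mul (by positivity) (Real.exp_pos _).ne', Real.log_exp, Real.log_pow, hlogρ]
    push_cast
    ring
  unfold noiseRadiusSq
  rw [← hm, hlog]
  linarith

/-- With probability at least `1 - δ`, the conditional means of the noise are bounded by `φ_d`
and the likelihood ratios of all parameters against `θ⋆` stay below the noise radius. -/
lemma confidence_event {Ω : Type*} [MeasurableSpace Ω] {μ : Measure Ω} [IsProbabilityMeasure μ]
    {p : ℕ} (hp : 0 < p) {B : ℝ} (hB : 0 < B) (θstar : EuclideanSpace ℝ (Fin p))
    {φ : ℕ → ℝ} {ε : ℕ → Ω → ℝ} (hε : IsMixingSubGaussian μ 1 φ ε)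
    {d : ℕ} (hd : 0 < d) {δ : ℝ} (hδ0 : 0 < δ)
    {X : ℕ → Ω → EuclideanSpace ℝ (Fin p)} (hX1 : ∀ t, 1 ≤ t → ∀ ω, ‖X t ω‖ ≤ 1)
    (hXm : ∀ t, 1 ≤ t → Measurable[noiseSigma ε (t - d)] (X t)) :
    ENNReal.ofReal (1 - δ) ≤ μ {ω | (∀ t, 1 ≤ t → |noiseBias μ ε d t ω| ≤ φ d) ∧
      ∀ (t : ℕ) (θ : EuclideanSpace ℝ (Fin p)), ‖θ‖ ≤ B →
        2 * ∑ s ∈ Finset.Icc 1 t, ⟪θ - θstar, X s ω⟫_ℝ * (ε s ω - noiseBias μ ε d s ω)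
          - ∑ s ∈ Finset.Icc 1 t, ⟪θ - θstar, X s ω⟫_ℝ ^ 2 ≤ noiseRadiusSq p d B δ t} := by
  have hdδ : (0 : ℝ) < d / δ := by positivity
  set π : Measure (EuclideanSpace ℝ (Fin p)) := cond volume (Metric.closedBall 0 (B + 1)) with hπ
  have : IsProbabilityMeasure π :=
    cond_isProbabilityMeasure_of_finite
      (Metric.measure_closedBall_pos _ _ (by linarith)).ne' measure_closedBall_lt_top.ne
  set bad : ℕ → Set Ω := fun i => {ω | ∃ n, ENNReal.ofReal (d / δ) ≤
    mixture π θstar (fun k => X (i + 1 + k * d) ω)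
      (fun k => ε (i + 1 + k * d) ω - noiseBias μ ε d (i + 1 + k * d) ω) n} with hbad
  -- The noise of one block round is known at the σ-field preceding the next round of the block,
  -- which makes the block a genuine filtration.
  have hstep : ∀ i n, i + 1 + (n + 1) * d - d = i + 1 + n * d := by
    intro i n
    rw [Nat.succ_mul]
    omega
  have hbadle : ∀ i, μ (bad i) ≤ ENNReal.ofReal (δ / d) := by
    intro i
    have h := mul_measure_exists_le_mixture_le_one (μ := μ)
      (H := fun n => noiseSigma ε (i + 1 + n * d - d))
      (x := fun k => X (i + 1 + k * d))
      (ξ := fun k ω => ε (i + 1 + k * d) ω - noiseBias μ ε d (i + 1 + k * d) ω)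
      (fun n => hε.noiseSigma_le _)
      (fun a b hab => noiseSigma_mono ε (Nat.sub_le_sub_right
        (Nat.add_le_add_left (Nat.mul_le_mul_right d hab) _) d))
      (fun n => hXm _ (by omega))
      (fun n => by
        rw [hstep]
        exact measurable_sub_noiseBias ε d (by omega))
      (fun n c A hA => hε.setLIntegral_exp_le hd (by omega) c hA)
      π θstar (ENNReal.ofReal (d / δ))
    have hne : ENNReal.ofReal (d / δ) ≠ 0 := (ENNReal.ofReal_pos.2 hdδ).ne'
    rw [← inv_div, ENNReal.ofReal_inv_of_pos hdδ]
    exact (ENNReal.le_inv_iff_mul_le).2 (by rwa [mul_comm] at h)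
  set good : Set Ω := {ω | (∀ t, 1 ≤ t → |noiseBias μ ε d t ω| ≤ φ d) ∧
      ∀ (t : ℕ) (θ : EuclideanSpace ℝ (Fin p)), ‖θ‖ ≤ B →
        2 * ∑ s ∈ Finset.Icc 1 t, ⟪θ - θstar, X s ω⟫_ℝ * (ε s ω - noiseBias μ ε d s ω)
          - ∑ s ∈ Finset.Icc 1 t, ⟪θ - θstar, X s ω⟫_ℝ ^ 2 ≤ noiseRadiusSq p d B δ t} with hgood
  set N : Set Ω := {ω | ¬ ∀ t, 1 ≤ t → |noiseBias μ ε d t ω| ≤ φ d} with hN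
  have hN0 : μ N = 0 := by
    refine ae_iff.1 (ae_all_iff.2 fun t => ?_)
    by_cases ht : 1 ≤ t
    · filter_upwards [hε.abs_noiseBias_le hd ht] with ω hω _ using hω
    · exact Filter.Eventually.of_forall fun _ h => absurd h ht
  have hcompl : goodᶜ ⊆ N ∪ ⋃ i ∈ Finset.range d, bad i := by
    intro ω hω
    by_contra hcon
    rw [Set.mem_union, not_or] at hcon
    have h1 : ∀ t, 1 ≤ t → |noiseBias μ ε d t ω| ≤ φ d := not_not.1 hcon.1
    refine hω ⟨h1, fun t θ hθ => ?_⟩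
    refine two_mul_sum_sub_le_noiseRadiusSq hp hd hB hδ0 (x := fun s => X s ω)
      (fun s hs => hX1 s hs ω) (ξ := fun s => ε s ω - noiseBias μ ε d s ω)
      (fun i hi n => ?_) t hθ
    by_contra hlt
    refine hcon.2 (Set.mem_biUnion (Finset.mem_range.2 hi) ⟨n, ?_⟩)
    exact not_lt.1 hlt
  have hle : μ goodᶜ ≤ ENNReal.ofReal δ := by
    calc μ goodᶜ ≤ μ N + μ (⋃ i ∈ Finset.range d, bad i) :=
          (measure_mono hcompl).trans (measure_union_le _ _)
      _ ≤ 0 + ∑ i ∈ Finset.range d, ENNReal.ofReal (δ / d) := by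
          rw [hN0]
          gcongr
          exact (measure_biUnion_finset_le _ _).trans (Finset.sum_le_sum fun i _ => hbadle i)
      _ = ENNReal.ofReal δ := by
          rw [zero_add, Finset.sum_const, Finset.card_range, ← ENNReal.ofReal_nsmul, nsmul_eq_mul,
            mul_div_cancel₀ _ (by positivity)]
  rw [ENNReal.ofReal_sub _ hδ0.le, ENNReal.ofReal_one, tsub_le_iff_right]
  -- Only subadditivity is used, so no measurability of `good`, which quantifies over uncountably
  -- many `θ`, is required.
  calc (1 : ℝ≥0∞) = μ (good ∪ goodᶜ) := by rw [Set.union_compl_self, measure_univ]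
    _ ≤ μ good + μ goodᶜ := measure_union_le _ _
    _ ≤ μ good + ENNReal.ofReal δ := by gcongr

/-! ### Constrained least squares and the rounds with coverage -/

section LeastSquares

variable {p : ℕ}

/-- The first order optimality condition of the constrained least squares estimator. -/
lemma IsLeastSquares.sum_sq_le {B : ℝ} {x : ℕ → EuclideanSpace ℝ (Fin p)} {e : ℕ → ℝ} {t : ℕ}
    {θstar θhat : EuclideanSpace ℝ (Fin p)} (hθ : ‖θstar‖ ≤ B)
    (h : IsLeastSquares B x (fun s => ⟪θstar, x s⟫_ℝ + e s) t θhat) :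
    ∑ s ∈ Finset.Icc 1 t, ⟪θhat - θstar, x s⟫_ℝ ^ 2
      ≤ ∑ s ∈ Finset.Icc 1 t, ⟪θhat - θstar, x s⟫_ℝ * e s := by
  set S := ∑ s ∈ Finset.Icc 1 t, ⟪θhat - θstar, x s⟫_ℝ ^ 2 with hS
  set P := ∑ s ∈ Finset.Icc 1 t, ⟪θhat - θstar, x s⟫_ℝ * e s with hP
  have hS0 : 0 ≤ S := Finset.sum_nonneg fun _ _ => sq_nonneg _
  -- The estimator is compared with the point a fraction `κ` of the way to `θstar`, which stays in
  -- the ball by convexity.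
  have key : ∀ κ : ℝ, 0 < κ → κ ≤ 1 → 2 * (S - P) ≤ κ * S := by
    intro κ h0 h1
    have hmem : (1 - κ) • θhat + κ • θstar ∈ Metric.closedBall (0 : EuclideanSpace ℝ (Fin p)) B :=
      convex_closedBall _ _ h.1 (by simpa using hθ) (by linarith) h0.le (by ring)
    have hmin := isMinOn_iff.1 h.2 _ hmem
    have hL : ∀ κ : ℝ, ∑ s ∈ Finset.Icc 1 t,
        (⟪(1 - κ) • θhat + κ • θstar, x s⟫_ℝ - (⟪θstar, x s⟫_ℝ + e s)) ^ 2
        = (1 - κ) ^ 2 * S - 2 * (1 - κ) * P + ∑ s ∈ Finset.Icc 1 t, e s ^ 2 := by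
      intro κ
      rw [hS, hP, Finset.mul_sum, Finset.mul_sum, ← Finset.sum_sub_distrib,
        ← Finset.sum_add_distrib]
      refine Finset.sum_congr rfl fun s _ => ?_
      rw [inner_add_left, real_inner_smul_left, real_inner_smul_left, inner_sub_left]
      ring
    have h2 := hL 0
    rw [sub_zero, one_smul, zero_smul, add_zero] at h2
    rw [h2, hL κ] at hmin
    have h3 : κ * (2 * (S - P)) ≤ κ * (κ * S) := by nlinarith
    exact le_of_mul_le_mul_left h3 h0
  by_contra hlt
  rw [not_le] at hlt
  have h1 := key 1 one_pos le_rfl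
  have hSpos : 0 < S := by linarith
  -- In place of the limit `κ → 0`, this `κ` gives `2(S - P) ≤ S - P`. The case `κ = 1` supplies `S
  -- > 0` and `P ≥ 0`, so this `κ` is admissible.
  have h2 := key ((S - P) / S) (div_pos (by linarith) hSpos) ((div_le_one hSpos).2 (by linarith))
  rw [div_mul_cancel₀ _ hSpos.ne'] at h2
  linarith

/-- If the confidence set misses `θ⋆` although the noise event holds, then `B > 1` and the
noise radius is large compared with the number of rounds. -/
lemma lt_noiseRadiusSq_of_not_covered {d : ℕ} {B : ℝ} (hB : 0 < B) {δ : ℝ}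
    {φ : ℕ → ℝ} (hφ : 0 ≤ φ d) {x : ℕ → EuclideanSpace ℝ (Fin p)} {e b : ℕ → ℝ} {t : ℕ}
    (ht : 1 ≤ t) (hx : ∀ s, 1 ≤ s → ‖x s‖ ≤ 1) (hb : ∀ s, 1 ≤ s → |b s| ≤ φ d)
    {θstar θhat : EuclideanSpace ℝ (Fin p)} (hθ : ‖θstar‖ ≤ B)
    (h : IsLeastSquares B x (fun s => ⟪θstar, x s⟫_ℝ + e s) t θhat)
    (hnoise : ∀ θ : EuclideanSpace ℝ (Fin p), ‖θ‖ ≤ B →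
      2 * ∑ s ∈ Finset.Icc 1 t, ⟪θ - θstar, x s⟫_ℝ * (e s - b s)
        - ∑ s ∈ Finset.Icc 1 t, ⟪θ - θstar, x s⟫_ℝ ^ 2 ≤ noiseRadiusSq p d B δ t)
    (hnc : betaSq p d B (1 / B ^ 2) δ φ t
      < weightedNormSq (covMatrix (1 / B ^ 2) x t) (θstar - θhat)) :
    1 < B ∧ (0 ≤ B + 1 - 2 * φ d →
      t * ((B + 1) * (B + 1 - 2 * φ d)) ≤ noiseRadiusSq p d B δ t) := by
  have ht0 : (0 : ℝ) < t := by exact_mod_cast ht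
  have hθhat : ‖θhat‖ ≤ B := by simpa using h.1
  have hu : ‖θhat - θstar‖ ≤ 2 * B := (norm_sub_le _ _).trans (by linarith)
  set R := noiseRadiusSq p d B δ t with hR
  set S := ∑ s ∈ Finset.Icc 1 t, ⟪θhat - θstar, x s⟫_ℝ ^ 2 with hS
  set Z := ∑ s ∈ Finset.Icc 1 t, |⟪θhat - θstar, x s⟫_ℝ| with hZ
  -- The noise event is applied at `θhat` itself: optimality gives `2S ≤ 2P`, hence `S ≤ 2P - S`,
  -- and replacing `e` by `e - b` costs the bias term.
  have hSR : S ≤ R + 2 * (φ d * Z) := by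
    have h1 := h.sum_sq_le hθ
    have h2 := hnoise θhat hθhat
    have h3 : ∑ s ∈ Finset.Icc 1 t, ⟪θhat - θstar, x s⟫_ℝ * e s
        - ∑ s ∈ Finset.Icc 1 t, ⟪θhat - θstar, x s⟫_ℝ * (e s - b s) ≤ φ d * Z := by
      rw [← Finset.sum_sub_distrib, hZ, Finset.mul_sum]
      refine Finset.sum_le_sum fun s hs => ?_
      have h4 := hb s (Finset.mem_Icc.1 hs).1
      calc ⟪θhat - θstar, x s⟫_ℝ * e s - ⟪θhat - θstar, x s⟫_ℝ * (e s - b s)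
          = ⟪θhat - θstar, x s⟫_ℝ * b s := by ring
        _ ≤ |⟪θhat - θstar, x s⟫_ℝ| * |b s| := (le_abs_self _).trans (abs_mul _ _).le
        _ ≤ |⟪θhat - θstar, x s⟫_ℝ| * φ d := by gcongr
        _ = _ := mul_comm _ _
    linarith
  have hZS : Z ^ 2 ≤ t * S := by
    have h1 := sq_sum_le_card_mul_sum_sq (s := Finset.Icc 1 t)
      (f := fun s => |⟪θhat - θstar, x s⟫_ℝ|)
    simpa [sq_abs] using h1
  have hZB : Z ≤ t * (2 * B) := by
    refine (Finset.sum_le_card_nsmul _ _ (2 * B) fun s hs => ?_).trans_eq (by simp)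
    refine (abs_real_inner_le_norm _ _).trans ?_
    exact (mul_le_of_le_one_right (norm_nonneg _) (hx s (Finset.mem_Icc.1 hs).1)).trans hu
  -- Comparing the violated radius with `hSR` cancels the noise radius and the regularisation `4`;
  -- only the two bias terms remain.
  have hZlow : t * (B + 1) < Z := by
    rw [weightedNormSq_covMatrix, betaSq_eq p d hB] at hnc
    have h1 : ∑ s ∈ Finset.Icc 1 t, ⟪θstar - θhat, x s⟫_ℝ ^ 2 = S := by
      refine Finset.sum_congr rfl fun s _ => ?_
      rw [← neg_sub θhat θstar, inner_neg_left, neg_sq]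
    have h2 : 1 / B ^ 2 * ‖θstar - θhat‖ ^ 2 ≤ 4 := by
      rw [norm_sub_rev, one_div, inv_mul_le_iff₀ (by positivity)]
      calc ‖θhat - θstar‖ ^ 2 ≤ (2 * B) ^ 2 := by gcongr
        _ = B ^ 2 * 4 := by ring
    rw [h1] at hnc
    have h3 : φ d * (t * (B + 1)) < φ d * Z := by linarith
    exact lt_of_mul_lt_mul_left h3 hφ
  refine ⟨by nlinarith, fun hpos => ?_⟩
  -- Cauchy–Schwarz gives `Z² ≤ tS ≤ t(R + 2φ_d Z)`.
  have h1 : Z * (Z - 2 * t * φ d) ≤ t * R := by nlinarith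
  have h2 : (t * (B + 1)) * (t * (B + 1 - 2 * φ d)) ≤ Z * (Z - 2 * t * φ d) := by
    have h3 : 0 ≤ t * (B + 1 - 2 * φ d) := by positivity
    have h4 : t * (B + 1 - 2 * φ d) ≤ Z - 2 * t * φ d := by linarith
    exact mul_le_mul hZlow.le h4 h3 (by nlinarith)
  have h3 : (t : ℝ) * (t * ((B + 1) * (B + 1 - 2 * φ d))) ≤ t * R := by linarith
  exact le_of_mul_le_mul_left h3 ht0

end LeastSquares

/-! ### Regret of optimistic play -/

section Regret

variable {p : ℕ}

/-- The instantaneous regret of an arm that is optimistic with respect to a set containing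
`θ⋆`. -/
lemma sq_inner_sub_le_of_ucb_le {C : Set (EuclideanSpace ℝ (Fin p))} {B m : ℝ}
    {θstar x xopt : EuclideanSpace ℝ (Fin p)} (hCB : C ⊆ Metric.closedBall 0 B)
    (hθC : θstar ∈ C) (hucb : ucb C xopt ≤ ucb C x)
    (hm : ∀ θ ∈ C, ⟪x, θ - θstar⟫_ℝ ^ 2 ≤ m) (hopt : 0 ≤ ⟪xopt - x, θstar⟫_ℝ) :
    ⟪xopt - x, θstar⟫_ℝ ^ 2 ≤ m := by
  have hbdd : BddAbove ((fun θ => ⟪xopt, θ⟫_ℝ) '' C) := by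
    refine ⟨‖xopt‖ * B, ?_⟩
    rintro _ ⟨θ, hθ, rfl⟩
    refine (real_inner_le_norm _ _).trans ?_
    have : ‖θ‖ ≤ B := by simpa using hCB hθ
    gcongr
  have h1 : ⟪xopt, θstar⟫_ℝ ≤ ucb C xopt := le_csSup hbdd ⟨θstar, hθC, rfl⟩
  have h2 : ucb C x ≤ ⟪x, θstar⟫_ℝ + Real.sqrt m := by
    refine csSup_le (Set.image_nonempty.2 ⟨θstar, hθC⟩) ?_
    rintro _ ⟨θ, hθ, rfl⟩
    have h3 := (le_abs_self _).trans (Real.abs_le_sqrt (hm θ hθ))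
    rw [inner_sub_right] at h3
    linarith
  have hm0 : 0 ≤ m := (sq_nonneg _).trans (hm θstar hθC)
  have h3 : ⟪xopt - x, θstar⟫_ℝ ≤ Real.sqrt m := by
    rw [inner_sub_left]
    linarith
  calc ⟪xopt - x, θstar⟫_ℝ ^ 2 ≤ Real.sqrt m ^ 2 := by gcongr
    _ = m := Real.sq_sqrt hm0

lemma weightedNormSq_covMatrix_sub_le {lam : ℝ} (hlam : 0 ≤ lam)
    (x : ℕ → EuclideanSpace ℝ (Fin p)) (t : ℕ) (u v : EuclideanSpace ℝ (Fin p)) :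
    weightedNormSq (covMatrix lam x t) (u - v)
      ≤ 2 * weightedNormSq (covMatrix lam x t) u + 2 * weightedNormSq (covMatrix lam x t) v := by
  simp only [weightedNormSq_covMatrix, inner_sub_left]
  have h1 : ‖u - v‖ ^ 2 ≤ 2 * ‖u‖ ^ 2 + 2 * ‖v‖ ^ 2 := by
    have := parallelogram_law_with_norm ℝ u v
    nlinarith [mul_self_nonneg ‖u + v‖]
  have h2 : ∑ s ∈ Finset.Icc 1 t, (⟪u, x s⟫_ℝ - ⟪v, x s⟫_ℝ) ^ 2
      ≤ 2 * ∑ s ∈ Finset.Icc 1 t, ⟪u, x s⟫_ℝ ^ 2 + 2 * ∑ s ∈ Finset.Icc 1 t, ⟪v, x s⟫_ℝ ^ 2 := by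
    rw [Finset.mul_sum, Finset.mul_sum, ← Finset.sum_add_distrib]
    refine Finset.sum_le_sum fun s _ => ?_
    nlinarith [sq_nonneg (⟪u, x s⟫_ℝ + ⟪v, x s⟫_ℝ)]
  nlinarith [mul_le_mul_of_nonneg_left h1 hlam]

/-- The leverage of round `t` given the earlier rounds of its block, where the blocks are the
residue classes modulo `d`. -/
def blockLeverage (lam : ℝ) (d : ℕ) (x : ℕ → EuclideanSpace ℝ (Fin p)) (t : ℕ) : ℝ :=
  leverage lam (fun k => x ((t - 1) % d + 1 + k * d)) ((t - 1) / d)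

lemma blockLeverage_nonneg {lam : ℝ} (hlam : 0 < lam) (d : ℕ)
    (x : ℕ → EuclideanSpace ℝ (Fin p)) (t : ℕ) : 0 ≤ blockLeverage lam d x t :=
  leverage_nonneg hlam _ _

/-- The delayed elliptical potential lemma. -/
lemma sum_min_one_blockLeverage_le (hp : 0 < p) {lam : ℝ} (hlam : 0 < lam) {d : ℕ} (hd : 0 < d)
    {x : ℕ → EuclideanSpace ℝ (Fin p)} (hx : ∀ t, 1 ≤ t → ‖x t‖ ≤ 1) (T : ℕ) :
    ∑ t ∈ Finset.Icc 1 T, min 1 (blockLeverage lam d x t)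
      ≤ 3 / 2 * (d * p * Real.log (1 + T / (d * p * lam))) := by
  have hdp : (0 : ℝ) < d * p := by positivity
  -- With this tangent point the linear terms of the `d` blocks cancel exactly in the sum.
  set a : ℝ := lam + T / (d * p) with ha
  have ha0 : 0 < a := by positivity
  set N : ℕ → ℕ := fun i => (T + d - 1 - i) / d with hN
  have hcount : ∑ i ∈ Finset.range d, (N i : ℝ) = T := sum_block_sizes hd T
  have hlog : ∑ t ∈ Finset.Icc 1 T, Real.log (1 + blockLeverage lam d x t)
      ≤ d * p * Real.log (a / lam) := by
    rw [sum_Icc_eq_sum_blocks hd]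
    calc ∑ i ∈ Finset.range d, ∑ k ∈ Finset.range (N i),
          Real.log (1 + blockLeverage lam d x (i + 1 + k * d))
        ≤ ∑ i ∈ Finset.range d, (p * Real.log (a / lam) + (N i + p * lam) / a - p) := by
          refine Finset.sum_le_sum fun i hi => ?_
          have hi' := Finset.mem_range.1 hi
          refine le_trans (le_of_eq ?_) (sum_log_one_add_leverage_le hlam
            (x := fun k => x (i + 1 + k * d)) (fun k _ => hx _ (by omega)) ha0)
          refine Finset.sum_congr rfl fun k _ => ?_
          have h : i + 1 + k * d - 1 = i + k * d := by omega
          simp only [blockLeverage, h, Nat.add_mul_mod_self_right, Nat.mod_eq_of_lt hi',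
            Nat.add_mul_div_right _ _ hd, Nat.div_eq_of_lt hi', zero_add]
      _ = d * p * Real.log (a / lam) + (T + d * p * lam) / a - d * p := by
          rw [Finset.sum_sub_distrib, Finset.sum_add_distrib, ← Finset.sum_div,
            Finset.sum_add_distrib, hcount]
          simp only [Finset.sum_const, Finset.card_range, nsmul_eq_mul]
          ring
      _ = d * p * Real.log (a / lam) := by
          have : T + d * p * lam = d * p * a := by
            rw [ha]
            field_simp
            ring
          rw [this, mul_div_cancel_right₀ _ ha0.ne']
          ring
  have hal : a / lam = 1 + T / (d * p * lam) := by
    rw [ha]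
    field_simp
  rw [hal] at hlog
  calc ∑ t ∈ Finset.Icc 1 T, min 1 (blockLeverage lam d x t)
      ≤ ∑ t ∈ Finset.Icc 1 T, 3 / 2 * Real.log (1 + blockLeverage lam d x t) :=
        Finset.sum_le_sum fun t _ => min_one_le_log_one_add (blockLeverage_nonneg hlam d x t)
    _ ≤ _ := by
        rw [← Finset.mul_sum]
        gcongr

/-- The earlier rounds of the block of `t` are all at most `t - d`, so the block Gram matrix is
dominated by `V_{t-d}` and Cauchy–Schwarz for the former suffices. -/
lemma inner_sq_le_blockLeverage_mul {lam : ℝ} (hlam : 0 < lam) {d : ℕ} (hd : 0 < d)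
    (x : ℕ → EuclideanSpace ℝ (Fin p)) {t : ℕ} (ht : d < t) (w : EuclideanSpace ℝ (Fin p)) :
    ⟪x t, w⟫_ℝ ^ 2
      ≤ blockLeverage lam d x t * weightedNormSq (covMatrix lam x (t - d)) w := by
  set i := (t - 1) % d with hi
  set k := (t - 1) / d with hk
  have hik : i + 1 + k * d = t := by
    have h : i + d * k = t - 1 := Nat.mod_add_div (t - 1) d
    rw [mul_comm] at h
    omega
  have h1 := inner_sq_le_weightedNormSq_inv_mul
    (gramMatrix_posDef hlam (fun k => x (i + 1 + k * d)) k) (x (i + 1 + k * d)) w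
  have h2 : blockLeverage lam d x t = weightedNormSq
      (gramMatrix lam (fun k => x (i + 1 + k * d)) k)⁻¹ (x (i + 1 + k * d)) := rfl
  rw [← h2, hik] at h1
  refine h1.trans (mul_le_mul_of_nonneg_left ?_ (blockLeverage_nonneg hlam d x t))
  rw [weightedNormSq_gramMatrix, weightedNormSq_covMatrix]
  gcongr
  rw [← Finset.sum_image (s := Finset.range k) (g := fun j => i + 1 + j * d)
    (f := fun s => ⟪w, x s⟫_ℝ ^ 2)]
  · refine Finset.sum_le_sum_of_subset_of_nonneg ?_ fun _ _ _ => sq_nonneg _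
    intro s hs
    obtain ⟨j, hj, rfl⟩ := Finset.mem_image.1 hs
    have hjk := Nat.mul_le_mul_right d (Nat.succ_le_of_lt (Finset.mem_range.1 hj))
    rw [Nat.succ_mul] at hjk
    rw [Finset.mem_Icc]
    omega
  · intro a _ b _ hab
    have : a * d = b * d := by simpa using hab
    exact Nat.eq_of_mul_eq_mul_right hd this

end Regret

/-! ### The gap-dependent bound, with the uncovered rounds accounted for -/

section Final

/-- Bernoulli's inequality. It gives the lower bound `log(1 + B²T)` for the potential, free of `dp`.
-/
lemma log_one_add_le_mul_log {n : ℝ} (hn : 1 ≤ n) {y : ℝ} (hy : 0 ≤ y) :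
    Real.log (1 + y) ≤ n * Real.log (1 + y / n) := by
  have hn0 : 0 < n := by linarith
  rw [← Real.log_rpow (by positivity)]
  refine Real.log_le_log (by linarith) ?_
  have h := one_add_mul_self_le_rpow_one_add (s := y / n)
    (by linarith [div_nonneg hy hn0.le]) hn
  rwa [mul_div_cancel₀ _ hn0.ne'] at h

/-- Of the `5/2`, at most `1/2` is lost to the bias and `2` remains to pay for the uncovered rounds.
On three ranges of `B` the logarithm is bounded below through `3`, `4` and `16`. -/
lemma mul_sq_le_log_mul_sq {B : ℝ} (hB : 1 < B) :
    5 / 2 * B ^ 2 ≤ Real.log (1 + 2 * B ^ 2) * (B + 1) ^ 2 := by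
  have hlog : ∀ y : ℝ, 0 < y → y ≤ 1 + 2 * B ^ 2 → Real.log y ≤ Real.log (1 + 2 * B ^ 2) :=
    fun y hy h => Real.log_le_log hy h
  have hpow : ∀ n : ℕ, Real.log ((2 : ℝ) ^ n) = n * Real.log 2 := fun n => Real.log_pow 2 n
  have h2 := Real.log_two_gt_d9
  rcases le_total B (8 / 5) with h | h
  · have h3 : 1 ≤ Real.log (1 + 2 * B ^ 2) := by
      refine le_trans ?_ (hlog 3 (by norm_num) (by nlinarith))
      rw [Real.le_log_iff_exp_le (by norm_num)]
      linarith [Real.exp_one_lt_d9]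
    nlinarith [mul_le_mul_of_nonneg_right h3 (sq_nonneg (B + 1))]
  rcases le_total B (14 / 5) with h' | h'
  · have h3 : 1.386 ≤ Real.log (1 + 2 * B ^ 2) := by
      refine le_trans ?_ (hlog (2 ^ 2) (by norm_num) (by nlinarith))
      rw [hpow]
      push_cast
      linarith
    nlinarith [mul_le_mul_of_nonneg_right h3 (sq_nonneg (B + 1))]
  · have h3 : 5 / 2 ≤ Real.log (1 + 2 * B ^ 2) := by
      refine le_trans ?_ (hlog (2 ^ 4) (by norm_num) (by nlinarith))
      rw [hpow]
      push_cast
      linarith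
    nlinarith [mul_le_mul_of_nonneg_right h3 (sq_nonneg (B + 1))]

lemma card_filter_sub_mul_le {c R : ℝ} (hc : 0 < c) (hR : 0 ≤ R) (d T : ℕ) :
    (((Finset.Icc 1 T).filter fun t => d < t ∧ ((t - d : ℕ) : ℝ) * c ≤ R).card : ℝ) * c ≤ R := by
  have hsub : ((Finset.Icc 1 T).filter fun t => d < t ∧ ((t - d : ℕ) : ℝ) * c ≤ R)
      ⊆ Finset.Ioc d (d + ⌊R / c⌋₊) := by
    intro t ht
    obtain ⟨-, hdt, hle⟩ := Finset.mem_filter.1 ht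
    have h := Nat.le_floor ((le_div_iff₀ hc).2 hle)
    rw [Finset.mem_Ioc]
    omega
  have h1 := Finset.card_le_card hsub
  rw [Nat.card_Ioc, Nat.add_sub_cancel_left] at h1
  rw [← le_div_iff₀ hc]
  exact (Nat.cast_le.2 h1).trans (Nat.floor_le (by positivity))

variable {p : ℕ}

lemma sSup_gap_eq {𝒳 : Set (EuclideanSpace ℝ (Fin p))} {θstar x xopt : EuclideanSpace ℝ (Fin p)}
    (hmem : xopt ∈ 𝒳) (hmax : IsMaxOn (fun z => ⟪z, θstar⟫_ℝ) 𝒳 xopt) :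
    sSup ((fun z => ⟪z, θstar⟫_ℝ - ⟪x, θstar⟫_ℝ) '' 𝒳) = ⟪xopt - x, θstar⟫_ℝ := by
  rw [inner_sub_left]
  refine IsGreatest.csSup_eq ⟨⟨xopt, hmem, rfl⟩, ?_⟩
  rintro _ ⟨z, hz, rfl⟩
  have := isMaxOn_iff.1 hmax z hz
  simp only at this ⊢
  linarith

lemma betaSq_mono {d : ℕ} (hp : 0 < p) (hd : 0 < d) {B : ℝ} (hB : 0 < B) (δ : ℝ) {φ : ℕ → ℝ}
    (hφ : 0 ≤ φ d) : Monotone (betaSq p d B (1 / B ^ 2) δ φ) := by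
  intro s t hst
  rw [betaSq_eq p d hB, betaSq_eq p d hB]
  have h1 := noiseRadiusSq_mono hp hd hB δ hst
  have h2 : (s : ℝ) ≤ t := by exact_mod_cast hst
  gcongr

/-- The gap-dependent regret bound, on the noise event. -/
lemma regret_le_of_confidence {d : ℕ} (hp : 0 < p) (hd : 0 < d) {B : ℝ} (hB : 0 < B) {δ : ℝ}
    (hδ0 : 0 < δ) (hδ1 : δ < 1) {φ : ℕ → ℝ} (hφ : 0 ≤ φ d)
    {𝒳 : ℕ → Set (EuclideanSpace ℝ (Fin p))}
    {x θhat : ℕ → EuclideanSpace ℝ (Fin p)} {e b : ℕ → ℝ}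
    (hx : ∀ s, 1 ≤ s → ‖x s‖ ≤ 1) (h𝒳 : ∀ t, 1 ≤ t → 𝒳 t ⊆ Metric.closedBall 0 1)
    (hmem : ∀ t, 1 ≤ t → x t ∈ 𝒳 t) (hb : ∀ s, 1 ≤ s → |b s| ≤ φ d)
    {θstar : EuclideanSpace ℝ (Fin p)} (hθ : ‖θstar‖ ≤ B)
    (hls : ∀ t, 1 ≤ t → IsLeastSquares B x (fun s => ⟪θstar, x s⟫_ℝ + e s) t (θhat t))
    (hopt : ∀ t, d < t →
      IsMaxOn (ucb (confSet d B (1 / B ^ 2) δ φ x (t - d) (θhat (t - d)))) (𝒳 t) (x t))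
    (hnoise : ∀ (t : ℕ) (θ : EuclideanSpace ℝ (Fin p)), ‖θ‖ ≤ B →
      2 * ∑ s ∈ Finset.Icc 1 t, ⟪θ - θstar, x s⟫_ℝ * (e s - b s)
        - ∑ s ∈ Finset.Icc 1 t, ⟪θ - θstar, x s⟫_ℝ ^ 2 ≤ noiseRadiusSq p d B δ t)
    {T : ℕ} (hT : d < T) {Δ : ℝ} (hΔ : 0 < Δ) (hgap : HasGap 𝒳 θstar T Δ) :
    regret 𝒳 θstar x T ≤ 2 * d * B
      + (8 * d * p / Δ) * max (B ^ 2) (betaSq p d B (1 / B ^ 2) δ φ T)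
        * Real.log (1 + B ^ 2 * T / (d * p)) := by
  have hlam : (0 : ℝ) < 1 / B ^ 2 := by positivity
  have hdp : (0 : ℝ) < d * p := by positivity
  have hdp1 : (1 : ℝ) ≤ d * p := by exact_mod_cast Nat.mul_pos hd hp
  have hT2 : (2 : ℝ) ≤ T := by exact_mod_cast (by omega : 2 ≤ T)
  set β := betaSq p d B (1 / B ^ 2) δ φ with hβ
  set R := noiseRadiusSq p d B δ with hR
  set Λ : ℝ := d * p * Real.log (1 + B ^ 2 * T / (d * p)) with hΛ
  set K : ℝ := max (B ^ 2) (β T) with hK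
  set r : ℕ → ℝ := fun t => sSup ((fun z => ⟪z, θstar⟫_ℝ - ⟪x t, θstar⟫_ℝ) '' 𝒳 t) with hr
  set q : ℕ → ℝ := blockLeverage (1 / B ^ 2) d x with hq
  have hβT : β T = R T + 4 + 2 * T * φ d * (B + 1) := betaSq_eq p d hB δ φ T
  have hRT : 0 ≤ R T := noiseRadiusSq_nonneg hp hd hB hδ0 hδ1 T
  have hφT : 0 ≤ 2 * T * φ d * (B + 1) := by positivity
  have hΛlog : Real.log (1 + B ^ 2 * T) ≤ Λ := log_one_add_le_mul_log hdp1 (by positivity)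
  have hΛ0 : 0 < Λ := (Real.log_pos (by nlinarith [sq_pos_of_pos hB])).trans_le hΛlog
  have hgoal : (8 * d * p / Δ) * K * Real.log (1 + B ^ 2 * T / (d * p)) = 8 * (Λ * K) / Δ := by
    rw [hΛ]
    ring
  rw [hgoal]
  -- The third bound is where the gap enters: the regret of a round is `0` or at least `Δ`.
  have hround : ∀ t ∈ Finset.Icc 1 T, 0 ≤ r t ∧ r t ≤ 2 * B ∧ r t ≤ r t ^ 2 / Δ ∧
      ∃ xopt ∈ 𝒳 t, r t = ⟪xopt - x t, θstar⟫_ℝ := by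
    intro t ht
    have ht1 := (Finset.mem_Icc.1 ht).1
    obtain ⟨xopt, hxo, hmax, hsep⟩ := hgap t ht
    have hrt : r t = ⟪xopt - x t, θstar⟫_ℝ := sSup_gap_eq hxo hmax
    have h0 : 0 ≤ r t := by
      rw [hrt, inner_sub_left]
      have := isMaxOn_iff.1 hmax _ (hmem t ht1)
      linarith
    have h2 : r t ≤ 2 * B := by
      rw [hrt]
      have h3 : ‖xopt‖ ≤ 1 := by simpa using h𝒳 t ht1 hxo
      have h4 : ‖xopt - x t‖ ≤ 2 := (norm_sub_le _ _).trans (by linarith [hx t ht1])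
      refine (real_inner_le_norm _ _).trans ?_
      gcongr
    refine ⟨h0, h2, ?_, xopt, hxo, hrt⟩
    by_cases hxx : x t = xopt
    · have : r t = 0 := by rw [hrt, hxx, sub_self, inner_zero_left]
      simp [this]
    · have := hsep _ (hmem t ht1) hxx
      rw [← hrt] at this
      rw [le_div_iff₀ hΔ, sq]
      gcongr
  have hbound : ∀ t ∈ Finset.Icc 1 T, r t ≤ 4 * B ^ 2 / Δ := by
    intro t ht
    obtain ⟨h0, h2, h3, -⟩ := hround t ht
    refine h3.trans ?_
    gcongr
    nlinarith
  have hfirst : ∑ t ∈ Finset.Icc 1 T, (if t ≤ d then 2 * B else 0) = 2 * d * B := by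
    rw [← Finset.sum_filter, Finset.sum_const, nsmul_eq_mul]
    have : (Finset.Icc 1 T).filter (fun t => t ≤ d) = Finset.Icc 1 d := by
      ext t
      simp only [Finset.mem_filter, Finset.mem_Icc]
      omega
    rw [this, Nat.card_Icc, Nat.add_sub_cancel]
    ring
  have hreg : regret 𝒳 θstar x T = ∑ t ∈ Finset.Icc 1 T, r t := rfl
  rw [hreg]
  -- In the first case charging `4B²/Δ` to every round is enough. The opposite inequality will make
  -- `φ_d` small, because `β T` contains a bias term linear in `T`.
  by_cases htriv : B ^ 2 * T ≤ 2 * (Λ * β T)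
  · calc ∑ t ∈ Finset.Icc 1 T, r t
        ≤ ∑ t ∈ Finset.Icc 1 T, ((if t ≤ d then 2 * B else 0) + 4 * B ^ 2 / Δ) := by
          refine Finset.sum_le_sum fun t ht => ?_
          have h1 := hbound t ht
          have h2 : (0 : ℝ) ≤ if t ≤ d then 2 * B else 0 := by split_ifs <;> positivity
          linarith
      _ = 2 * d * B + 4 * (B ^ 2 * T) / Δ := by
          rw [Finset.sum_add_distrib, hfirst, Finset.sum_const, Nat.card_Icc, Nat.add_sub_cancel,
            nsmul_eq_mul]
          ring
      _ ≤ 2 * d * B + 8 * (Λ * K) / Δ := by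
          have h3 : Λ * β T ≤ Λ * K := by
            gcongr
            exact le_max_right _ _
          gcongr 2 * d * B + ?_ / Δ
          linarith
  rw [not_le] at htriv
  set c : ℝ := (B + 1) * (B + 1 - 2 * φ d) with hc
  set unc : ℕ → Prop := fun t => d < t ∧ β (t - d)
    < weightedNormSq (covMatrix (1 / B ^ 2) x (t - d)) (θstar - θhat (t - d)) with hunc
  -- The failure of `htriv` gives `4Λφ_d(B + 1) < B²`, so the negative part of `cΛ` costs at most
  -- `B²/2`. Here `T ≥ 2` puts `log(1 + 2B²)` below `Λ`.
  have hcΛ : 1 < B → 2 * B ^ 2 ≤ c * Λ := by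
    intro hB1
    have h1 : Real.log (1 + 2 * B ^ 2) ≤ Λ :=
      (Real.log_le_log (by positivity) (by nlinarith [sq_pos_of_pos hB])).trans hΛlog
    have h2 : 5 / 2 * B ^ 2 ≤ Λ * (B + 1) ^ 2 :=
      (mul_sq_le_log_mul_sq hB1).trans (by gcongr)
    have h3 : Λ * (2 * T * φ d * (B + 1)) ≤ Λ * β T := by
      gcongr
      linarith
    have h4 : (T : ℝ) * (4 * (Λ * φ d * (B + 1))) < T * B ^ 2 := by linarith
    have h5 := lt_of_mul_lt_mul_left h4 (by linarith)
    have h6 : c * Λ = Λ * (B + 1) ^ 2 - 2 * (Λ * φ d * (B + 1)) := by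
      rw [hc]
      ring
    linarith
  have huncov : ∀ t ∈ Finset.Icc 1 T, unc t → 1 < B ∧ ((t - d : ℕ) : ℝ) * c ≤ R T := by
    intro t ht hu
    have h := lt_noiseRadiusSq_of_not_covered hB hφ (Nat.sub_pos_of_lt hu.1) hx hb hθ
      (hls (t - d) (Nat.sub_pos_of_lt hu.1)) (hnoise (t - d)) hu.2
    refine ⟨h.1, (h.2 ?_).trans (noiseRadiusSq_mono hp hd hB δ ?_)⟩
    · have h1 : 0 < c * Λ := lt_of_lt_of_le (by positivity) (hcΛ h.1)
      have h2 : 0 < c := pos_of_mul_pos_left h1 hΛ0.le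
      exact (pos_of_mul_pos_right h2 (by linarith)).le
    · exact (Nat.sub_le t d).trans (Finset.mem_Icc.1 ht).2
  classical
  -- An uncovered round has `(t - d)c ≤ R T`, so there are at most `R T / c` of them, and `2B² ≤ cΛ`
  -- turns their total charge into the potential.
  have hcount : 4 * B ^ 2 * (((Finset.Icc 1 T).filter unc).card : ℝ) ≤ 2 * (Λ * β T) := by
    rcases Finset.eq_empty_or_nonempty ((Finset.Icc 1 T).filter unc) with he | ⟨t₀, ht₀⟩
    · rw [he, Finset.card_empty, Nat.cast_zero, mul_zero]
      have : 0 ≤ β T := by linarith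
      positivity
    · have hB1 := (huncov t₀ (Finset.mem_filter.1 ht₀).1 (Finset.mem_filter.1 ht₀).2).1
      have h1 := hcΛ hB1
      have hc0 : 0 < c := pos_of_mul_pos_left (lt_of_lt_of_le (by positivity) h1) hΛ0.le
      have hsub : (Finset.Icc 1 T).filter unc
          ⊆ (Finset.Icc 1 T).filter fun t => d < t ∧ ((t - d : ℕ) : ℝ) * c ≤ R T := by
        intro t ht
        obtain ⟨h2, h3⟩ := Finset.mem_filter.1 ht
        exact Finset.mem_filter.2 ⟨h2, h3.1, (huncov t h2 h3).2⟩
      have h4 : (((Finset.Icc 1 T).filter unc).card : ℝ) * c ≤ R T :=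
        le_trans (by gcongr) (card_filter_sub_mul_le hc0 hRT d T)
      calc 4 * B ^ 2 * (((Finset.Icc 1 T).filter unc).card : ℝ)
          = 2 * (2 * B ^ 2) * (((Finset.Icc 1 T).filter unc).card : ℝ) := by ring
        _ ≤ 2 * (c * Λ) * (((Finset.Icc 1 T).filter unc).card : ℝ) := by gcongr
        _ = 2 * (Λ * ((((Finset.Icc 1 T).filter unc).card : ℝ) * c)) := by ring
        _ ≤ 2 * (Λ * β T) := by
          gcongr
          linarith
  -- For small leverage, both `θ` and `θstar` lie within the radius of the estimator, which gives
  -- the factor `4`; for leverage above `1`, the crude bound `(2B)²` is used, whence the maximum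
  -- with `B²` in `K`.
  have hcov : ∀ t ∈ Finset.Icc 1 T, d < t → ¬ unc t → r t ^ 2 ≤ 4 * K * min 1 (q t) := by
    intro t ht hdt hnu
    have ht1 := (Finset.mem_Icc.1 ht).1
    obtain ⟨h0, -, -, xopt, hxo, hrt⟩ := hround t ht
    have hθC : θstar ∈ confSet d B (1 / B ^ 2) δ φ x (t - d) (θhat (t - d)) :=
      ⟨by simpa using hθ, not_lt.1 fun h => hnu ⟨hdt, h⟩⟩
    rw [hrt] at h0 ⊢
    refine sq_inner_sub_le_of_ucb_le (fun θ hθ' => hθ'.1) hθC (isMaxOn_iff.1 (hopt t hdt) _ hxo)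
      (fun θ hθ' => ?_) h0
    have hq0 : 0 ≤ q t := blockLeverage_nonneg hlam d x t
    have hβle : β (t - d) ≤ β T :=
      betaSq_mono hp hd hB δ hφ ((Nat.sub_le t d).trans (Finset.mem_Icc.1 ht).2)
    rcases le_total (q t) 1 with h1 | h1
    · rw [min_eq_right h1]
      have h2 := inner_sq_le_blockLeverage_mul hlam hd x hdt (θ - θstar)
      have h3 := weightedNormSq_covMatrix_sub_le hlam.le x (t - d) (θ - θhat (t - d))
        (θstar - θhat (t - d))
      rw [sub_sub_sub_cancel_right] at h3
      have h4 : weightedNormSq (covMatrix (1 / B ^ 2) x (t - d)) (θ - θstar) ≤ 4 * K := by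
        have h5 := hθ'.2
        have h6 := hθC.2
        have h7 : β T ≤ K := le_max_right _ _
        simp only [← hβ] at h5 h6
        linarith
      calc ⟪x t, θ - θstar⟫_ℝ ^ 2 ≤ q t * (4 * K) := h2.trans (by gcongr)
        _ = 4 * K * q t := by ring
    · rw [min_eq_left h1, mul_one]
      have h2 : ‖θ‖ ≤ B := by simpa using hθ'.1
      have h3 : ‖θ - θstar‖ ≤ 2 * B := (norm_sub_le _ _).trans (by linarith)
      have h4 : |⟪x t, θ - θstar⟫_ℝ| ≤ 2 * B :=
        (abs_real_inner_le_norm _ _).trans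
          ((mul_le_of_le_one_left (norm_nonneg _) (hx t ht1)).trans h3)
      have h5 : B ^ 2 ≤ K := le_max_left _ _
      rw [← sq_abs]
      calc |⟪x t, θ - θstar⟫_ℝ| ^ 2 ≤ (2 * B) ^ 2 := by gcongr
        _ ≤ 4 * K := by linarith
  have hK0 : 0 ≤ K := (sq_nonneg B).trans (le_max_left _ _)
  calc ∑ t ∈ Finset.Icc 1 T, r t
      ≤ ∑ t ∈ Finset.Icc 1 T, ((if t ≤ d then 2 * B else 0) + 4 * K / Δ * min 1 (q t)
          + if unc t then 4 * B ^ 2 / Δ else 0) := by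
        refine Finset.sum_le_sum fun t ht => ?_
        have hq0 : 0 ≤ 4 * K / Δ * min 1 (q t) :=
          mul_nonneg (by positivity) (le_min zero_le_one (blockLeverage_nonneg hlam d x t))
        have hA : (0 : ℝ) ≤ if t ≤ d then 2 * B else 0 := by split_ifs <;> positivity
        have hC : (0 : ℝ) ≤ if unc t then 4 * B ^ 2 / Δ else 0 := by split_ifs <;> positivity
        obtain ⟨-, h2, h3, -⟩ := hround t ht
        by_cases htd : t ≤ d
        · rw [if_pos htd]
          linarith
        by_cases hu : unc t
        · rw [if_pos hu]
          linarith [hbound t ht]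
        · have h4 : r t ^ 2 / Δ ≤ 4 * K * min 1 (q t) / Δ := by
            gcongr
            exact hcov t ht (not_le.1 htd) hu
          have h5 : 4 * K * min 1 (q t) / Δ = 4 * K / Δ * min 1 (q t) := by ring
          linarith
    _ = 2 * d * B + 4 * K / Δ * ∑ t ∈ Finset.Icc 1 T, min 1 (q t)
          + 4 * B ^ 2 * (((Finset.Icc 1 T).filter unc).card : ℝ) / Δ := by
        rw [Finset.sum_add_distrib, Finset.sum_add_distrib, hfirst, ← Finset.mul_sum,
          ← Finset.sum_filter, Finset.sum_const, nsmul_eq_mul]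
        ring
    -- The budget of the constant: `4 · 3/2 = 6` from the covered rounds and `2` from the uncovered
    -- ones.
    _ ≤ 2 * d * B + 4 * K / Δ * (3 / 2 * Λ) + 2 * (Λ * K) / Δ := by
        have h1 := sum_min_one_blockLeverage_le hp hlam hd hx T
        have h2 : (T : ℝ) / (d * p * (1 / B ^ 2)) = B ^ 2 * T / (d * p) := by
          field_simp
        rw [h2] at h1
        have h3 : β T ≤ K := le_max_right _ _
        have h4 : 4 * B ^ 2 * (((Finset.Icc 1 T).filter unc).card : ℝ) ≤ 2 * (Λ * K) :=
          hcount.trans (by gcongr)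
        exact add_le_add (add_le_add le_rfl (by gcongr)) (div_le_div_of_nonneg_right h4 hΔ.le)
    _ = 2 * d * B + 8 * (Λ * K) / Δ := by ring

end Final

end MixingBandit

end

theorem theorem3 {Ω : Type*} [MeasurableSpace Ω] (μ : Measure Ω) [IsProbabilityMeasure μ]
    (p : ℕ) (hp : 0 < p)
    (B : ℝ) (hB : 0 < B)
    (θstar : EuclideanSpace ℝ (Fin p)) (hθ : ‖θstar‖ ≤ B)
    (𝒳 : ℕ → Set (EuclideanSpace ℝ (Fin p)))
    (h𝒳 : ∀ t, 1 ≤ t → 𝒳 t ⊆ Metric.closedBall 0 1)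
    (φ : ℕ → ℝ) (ε : ℕ → Ω → ℝ)
    (hε : MixingBandit.IsMixingSubGaussian μ 1 φ ε)
    (d : ℕ) (hd : 0 < d) (δ : ℝ) (hδ0 : 0 < δ) (hδ1 : δ < 1)
    (X θhat : ℕ → Ω → EuclideanSpace ℝ (Fin p))
    (hX : MixingBandit.IsMixingLinUCB d B (1 / B ^ 2) δ φ 𝒳 θstar ε X θhat) :
    ENNReal.ofReal (1 - δ) ≤
      μ {ω | ∀ T : ℕ, d < T → ∀ Δ : ℝ, 0 < Δ → MixingBandit.HasGap 𝒳 θstar T Δ →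
        MixingBandit.regret 𝒳 θstar (fun t => X t ω) T ≤
          2 * d * B + (8 * d * p / Δ)
            * max (B ^ 2) (MixingBandit.betaSq p d B (1 / B ^ 2) δ φ T)
            * Real.log (1 + B ^ 2 * T / (d * p))} := by
  have hX1 : ∀ t, 1 ≤ t → ∀ ω, ‖X t ω‖ ≤ 1 := fun t ht ω => by
    simpa using h𝒳 t ht (hX.mem t ht ω)
  refine (MixingBandit.confidence_event hp hB θstar hε hd hδ0 hX1 hX.measurable).trans
    (measure_mono ?_)
  -- The confidence event depends on neither `T` nor `Δ`, so the bound holds for all of them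
  -- simultaneously.
  rintro ω ⟨hb, hnoise⟩ T hT Δ hΔ hgap
  exact MixingBandit.regret_le_of_confidence hp hd hB hδ0 hδ1 (hε.phi_nonneg d)
    (fun s hs => hX1 s hs ω) h𝒳 (fun t ht => hX.mem t ht ω) hb hθ
    (fun t ht => hX.leastSquares t ht ω) (fun t ht => hX.optimistic t ht ω) hnoise hT hΔ hgap
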